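/- Let $a<b$, $\Omega=(a,b)$, $\beta\ge 0$, $\kappa>0$ and $-\kappa<m_0<1$, with $m_0>0$ if $\beta=0$. Put $$c=\frac{1-m_0}{1+\kappa}\in(0,1),\qquad \beta^*=\frac{2}{c\sqrt\kappa}\arctan\frac{1}{\sqrt\kappa}.$$ For a weight $m\in L^\infty(\Omega)$ that is positive on a set of positive measure, let $\lambda(m)$ be the positive principal eigenvalue of $$u''+\lambda m u=0\ \text{ a.e. in }(a,b),\qquad u'(a)=\beta u(a),\qquad u'(b)=-\beta u(b),$$ that is, the number $\lambda>0$ for which there is a solution $u\in C^1([a,b])$ with $u'$ absolutely continuous and $u>0$ in $(a,b)$. Let $\mathcal M_{m_0,\kappa}$ be the set of measurable $m$ on $\Omega$ with $-1\le m\le\kappa$ a.e., $|\{m>0\}|>0$ and $\int_\Omega m\le -m_0|\Omega|$. For measurable $E\subseteq\Omega$ with $|E|>0$ put $m_E=\kappa\chi_E-\chi_{\Omega\setminus E}$. Call $E^*$ optimal if it minimises $E\mapsto\lambda(m_E)$ among the measurable sets $E\subseteq\Omega$ with $0<|E|\le c(b-a)$. Then, for measurable sets $E\subseteq \Omega$ and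 up to sets of measure zero: 1. if $\beta>\frac{\beta^*}{b-a}$, then $E$ is optimal if and only if $E=\left(\frac{a+b}{2}-\frac{c(b-a)}{2},\ \frac{a+b}{2}+\frac{c(b-a)}{2}\right)$; 2. if $\beta=\frac{\beta^*}{b-a}$, then $E$ is optimal if and only if $E$ is an open subinterval of $\Omega$ of length $c(b-a)$; 3. if $\beta<\frac{\beta^*}{b-a}$, then $E$ is optimal if and only if $E=(a,a+c(b-a))$ or $E=(b-c(b-a),b)$. Moreover, a weight $m$ minimises $\lambda$ over $\mathcal M_{m_0,\kappa}$ if and only if $m=m_E$ a.e. in $\Omega$ for some optimal set $E$. -/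

import Mathlib

open Set MeasureTheory

noncomputable section

namespace RobinWeight

/-- `u` is a positive (strong, i.e. `W^{2,∞}`) solution on the interval `(a, b)` of the weighted
Robin problem `u'' + lam * m * u = 0` in `(a, b)`, `u'(a) = β u(a)`, `u'(b) = -β u(b)`:
`u` is continuously differentiable on `[a, b]` with derivative `p` (one-sided at the endpoints),
`p` is absolutely continuous, and the differential equation holds almost everywhere.
Only the values of `u` and `p` on `[a, b]` matter. -/
structure IsPositiveEigenfunction (a b β : ℝ) (m : ℝ → ℝ) (lam : ℝ) (u p : ℝ → ℝ) : Prop where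
  pos : ∀ x ∈ Ioo a b, 0 < u x
  hasDeriv : ∀ x ∈ Icc a b, HasDerivWithinAt u (p x) (Icc a b) x
  absCont : AbsolutelyContinuousOnInterval p a b
  eqn : ∀ᵐ x ∂(volume.restrict (Ioo a b)), HasDerivAt p (-(lam * m x * u x)) x
  left : p a = β * u a
  right : p b = -β * u b

/-- `lam` is a positive principal eigenvalue of the weighted Robin problem on `(a, b)`:
it is positive and has an eigenfunction that is positive in `(a, b)`. -/
def IsPrincipalEigenvalue (a b β : ℝ) (m : ℝ → ℝ) (lam : ℝ) : Prop :=
  0 < lam ∧ ∃ u p : ℝ → ℝ, IsPositiveEigenfunction a b β m lam u p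

/-- The positive principal eigenvalue `λ(m)`. For the weights considered here there is exactly
one positive principal eigenvalue, so the infimum is the infimum of a singleton. -/
def principalEigenvalue (a b β : ℝ) (m : ℝ → ℝ) : ℝ :=
  sInf {lam : ℝ | IsPrincipalEigenvalue a b β m lam}

/-- The class `M_{m₀, κ}` of admissible weights on `(a, b)`: measurable, `-1 ≤ m ≤ κ` a.e.,
positive on a set of positive measure, and `∫ m ≤ -m₀ (b - a)`. -/
structure IsAdmissibleWeight (a b κ m₀ : ℝ) (m : ℝ → ℝ) : Prop where
  aemeasurable : AEMeasurable m (volume.restrict (Ioo a b))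
  bounds : ∀ᵐ x ∂(volume.restrict (Ioo a b)), -1 ≤ m x ∧ m x ≤ κ
  pos_part : 0 < volume.restrict (Ioo a b) {x | 0 < m x}
  integral_le : ∫ x in Ioo a b, m x ≤ -m₀ * (b - a)

/-- `m` minimises the principal eigenvalue among the admissible weights. -/
def IsOptimalWeight (a b β κ m₀ : ℝ) (m : ℝ → ℝ) : Prop :=
  IsAdmissibleWeight a b κ m₀ m ∧
    ∀ w : ℝ → ℝ, IsAdmissibleWeight a b κ m₀ w →
      principalEigenvalue a b β m ≤ principalEigenvalue a b β w

/-- The weight `κ χ_E - χ_{(a, b) \ E}`. -/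
def setWeight (a b κ : ℝ) (E : Set ℝ) (x : ℝ) : ℝ :=
  κ * E.indicator 1 x - (Ioo a b \ E).indicator 1 x

/-- The class `E_{c}` of admissible sets: measurable `E ⊆ (a, b)` with `0 < |E| ≤ c (b - a)`. -/
structure IsAdmissibleSet (a b c : ℝ) (E : Set ℝ) : Prop where
  measurable : MeasurableSet E
  subset : E ⊆ Ioo a b
  pos : 0 < volume E
  le : volume E ≤ ENNReal.ofReal (c * (b - a))

/-- `E` minimises the principal eigenvalue of the weight `κ χ_E - χ_{(a, b) \ E}` among the
admissible sets. -/
def IsOptimalSet (a b β κ c : ℝ) (E : Set ℝ) : Prop :=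
  IsAdmissibleSet a b c E ∧
    ∀ F : Set ℝ, IsAdmissibleSet a b c F →
      principalEigenvalue a b β (setWeight a b κ E) ≤
        principalEigenvalue a b β (setWeight a b κ F)

/-- The threshold `β*` on the unit interval. -/
def betaStar (c κ : ℝ) : ℝ := 2 / (c * √κ) * Real.arctan (1 / √κ)

end RobinWeight

end

/-!
For a positive eigenfunction `u` the Riccati variable `v = u' / u` solves `v' = -lam m - v²` with
`v(a) = β` and `v(b) = -β`. Writing `m = (1 + κ) θ - 1`, this becomes a scalar control system with
control `θ ∈ [0, 1]`: the state coasts along `v' = lam - v²` where `θ = 0` and descends along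
`v' = -(v² + lam κ)` where `θ = 1`, and the constraint on the weight says that the cost `∫ θ` is at
most `c (b - a)`. Minimising the eigenvalue is equivalent to minimising the cost of driving the
state from `β` to `-β` in the time `b - a` at a fixed parameter `lam`.

The minimal cost at fixed `lam` is computed with calibrations, that is, by integrating the
derivative of suitable multiples of `descentTime` and `coastTime` along `v`
(`IsControlled.descent_le`, `IsControlled.coast_le`). Three cases arise. If `lam < β²`, the state
coasts down from `β`, descends across `0`, and coasts to `-β`, which gives a centred interval
(`IsControlled.le_integral_of_lt_sq`). If `lam = β²`, the state may rest at `β` and at `-β`, and the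
position of the interval is free (`IsControlled.le_integral_of_eq_sq`). If `lam > β²`, the descent
comes last or, after reflection, first, which gives an interval at an endpoint
(`IsControlled.le_integral_of_sq_lt`). The case is found by comparing the length of an interval
with the time of the descent from `√lam` to `-√lam`, which is `betaStar c κ * c / √lam`
(`two_mul_descentTime_sqrt`, `exists_eigenvalue_of_interval`).

A weight with an eigenvalue below the candidate value `lamS` is excluded by
`le_of_forall_isControlled`: a multiple `σ θ` of its control with `σ < 1` would join the same states
at the parameter `lamS` at a cost below the minimum. The multiple is found by shooting
(`exists_positive_solution`), which rests on solutions of the linear equation that depend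
continuously on a parameter (`exists_linear_family`, by inverting a Volterra operator). Shooting
also yields the existence of the principal eigenvalue (`exists_isPrincipalEigenvalue`). Uniqueness
follows from the concavity of `v ↦ -v²` (`ae_eq_zero_of_supersolution`).
-/

namespace RobinWeight

/-! ### Absolutely continuous functions -/

theorem ac_integral_eq_sub {f f' : ℝ → ℝ} {p q : ℝ} (hpq : p ≤ q)
    (hf : AbsolutelyContinuousOnInterval f p q)
    (hd : ∀ᵐ x, x ∈ Ioo p q → HasDerivAt f (f' x) x) :
    IntervalIntegrable f' volume p q ∧ ∫ x in p..q, f' x = f q - f p := by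
  have hae : ∀ᵐ x, x ∈ uIoc p q → deriv f x = f' x := by
    have hq : ∀ᵐ x : ℝ, x ≠ q := by simp [ae_iff, measure_singleton]
    filter_upwards [hd, hq] with x hx hxq hxm
    rw [uIoc_of_le hpq] at hxm
    exact (hx ⟨hxm.1, lt_of_le_of_ne hxm.2 hxq⟩).deriv
  refine ⟨hf.intervalIntegrable_deriv.congr_ae ?_, ?_⟩
  · rw [Filter.EventuallyEq, ae_restrict_iff' measurableSet_uIoc]
    exact hae
  · rw [← hf.integral_deriv_eq_sub]
    exact (intervalIntegral.integral_congr_ae hae).symm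

theorem ac_mono {f : ℝ → ℝ} {a b p q : ℝ} (hf : AbsolutelyContinuousOnInterval f a b)
    (hap : a ≤ p) (hpq : p ≤ q) (hqb : q ≤ b) : AbsolutelyContinuousOnInterval f p q :=
  hf.mono (by
    rw [uIcc_of_le hpq, uIcc_of_le (hap.trans (hpq.trans hqb))]
    exact Icc_subset_Icc hap hqb)

theorem ac_antitoneOn {f f' : ℝ → ℝ} {a b : ℝ}
    (hf : AbsolutelyContinuousOnInterval f a b)
    (hd : ∀ᵐ x, x ∈ Ioo a b → HasDerivAt f (f' x) x)
    (hn : ∀ᵐ x, x ∈ Ioo a b → f' x ≤ 0) : AntitoneOn f (Icc a b) := by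
  intro p hp q hq hpq
  have h := ac_integral_eq_sub hpq (ac_mono hf hp.1 hpq hq.2)
    (hd.mono fun x hx hxm => hx (Ioo_subset_Ioo hp.1 hq.2 hxm))
  have h2 : ∫ x in p..q, f' x ≤ 0 := by
    have h3 : 0 ≤ ∫ x in p..q, -f' x := by
      rw [intervalIntegral.integral_of_le hpq, integral_Ioc_eq_integral_Ioo]
      refine setIntegral_nonneg_of_ae_restrict ?_
      rw [Filter.EventuallyLE, ae_restrict_iff' measurableSet_Ioo]
      filter_upwards [hn] with x hx hxm
      simpa using hx (Ioo_subset_Ioo hp.1 hq.2 hxm)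
    rw [intervalIntegral.integral_neg] at h3
    linarith
  linarith [h.2]

/-- An almost everywhere statement on a nondegenerate interval holds at some point of it. -/
theorem exists_mem_Ioo_of_ae {P : ℝ → Prop} {p q : ℝ} (hpq : p < q)
    (h : ∀ᵐ x, x ∈ Ioo p q → P x) : ∃ x ∈ Ioo p q, P x := by
  by_contra! hc
  have h1 : ∀ᵐ x : ℝ, x ∉ Ioo p q := by
    filter_upwards [h] with x hx hxm
    exact hc x hxm (hx hxm)
  have h2 : volume (Ioo p q) = 0 := measure_eq_zero_iff_ae_notMem.2 h1
  rw [Real.volume_Ioo, ENNReal.ofReal_eq_zero] at h2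
  linarith

theorem hasDerivAt_zero_of_const {f : ℝ → ℝ} {p q x y c : ℝ} (hx : x ∈ Ioo p q)
    (hc : ∀ t ∈ Ioo p q, f t = c) (hd : HasDerivAt f y x) : y = 0 := by
  have h : HasDerivAt f 0 x := by
    refine (hasDerivAt_const x c).congr_of_eventuallyEq ?_
    filter_upwards [isOpen_Ioo.mem_nhds hx] with t ht using hc t ht
  exact hd.unique h

theorem ac_strictAntiOn {f f' : ℝ → ℝ} {a b : ℝ}
    (hf : AbsolutelyContinuousOnInterval f a b)
    (hd : ∀ᵐ x, x ∈ Ioo a b → HasDerivAt f (f' x) x)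
    (hn : ∀ᵐ x, x ∈ Ioo a b → f' x < 0) : StrictAntiOn f (Icc a b) := by
  have hm := ac_antitoneOn hf hd (hn.mono fun x hx hxm => (hx hxm).le)
  intro p hp q hq hpq
  refine lt_of_le_of_ne (hm hp hq hpq.le) fun heq => ?_
  obtain ⟨x, hx, h1, h2⟩ := exists_mem_Ioo_of_ae hpq (P := fun x => HasDerivAt f (f' x) x ∧ f' x < 0)
    (by filter_upwards [hd, hn] with x h1 h2 hx
        exact ⟨h1 (Ioo_subset_Ioo hp.1 hq.2 hx), h2 (Ioo_subset_Ioo hp.1 hq.2 hx)⟩)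
  have := hasDerivAt_zero_of_const hx (c := f p) (fun t ht => by
    have htm : t ∈ Icc a b := ⟨hp.1.trans ht.1.le, ht.2.le.trans hq.2⟩
    exact le_antisymm (hm hp htm ht.1.le) (heq ▸ hm htm hq ht.2.le)) h1
  linarith

theorem ac_lipschitz_comp {f Φ : ℝ → ℝ} {a b : ℝ} {K : NNReal} {s : Set ℝ}
    (hf : AbsolutelyContinuousOnInterval f a b) (hΦ : LipschitzOnWith K Φ s)
    (hs : MapsTo f (uIcc a b) s) : AbsolutelyContinuousOnInterval (fun x => Φ (f x)) a b := by
  rw [absolutelyContinuousOnInterval_iff] at hf ⊢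
  intro ε hε
  obtain ⟨δ, hδ, h⟩ := hf (ε / (K + 1)) (by positivity)
  refine ⟨δ, hδ, fun E hE hEδ => ?_⟩
  have h1 := h E hE hEδ
  calc ∑ i ∈ Finset.range E.1, dist (Φ (f (E.2 i).1)) (Φ (f (E.2 i).2))
      ≤ ∑ i ∈ Finset.range E.1, (K + 1) * dist (f (E.2 i).1) (f (E.2 i).2) := by
        refine Finset.sum_le_sum fun i hi => ?_
        have h2 := hE.1 i hi
        refine (hΦ.dist_le_mul _ (hs h2.1) _ (hs h2.2)).trans ?_
        gcongr
        linarith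
    _ = (K + 1) * ∑ i ∈ Finset.range E.1, dist (f (E.2 i).1) (f (E.2 i).2) := by
        rw [Finset.mul_sum]
    _ < (K + 1) * (ε / (K + 1)) := by gcongr
    _ = ε := by field_simp

/-- The image of the interval is again a compact interval, on which a `C¹` function is
Lipschitz. -/
theorem ac_comp {f Φ : ℝ → ℝ} {a b : ℝ} (hf : AbsolutelyContinuousOnInterval f a b)
    (hΦ : ∀ x ∈ uIcc a b, ContDiffAt ℝ 1 Φ (f x)) :
    AbsolutelyContinuousOnInterval (fun x => Φ (f x)) a b := by
  have hconv : Convex ℝ (f '' uIcc a b) :=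
    ((isPreconnected_uIcc.image f hf.continuousOn).ordConnected).convex
  have hcomp : IsCompact (f '' uIcc a b) := isCompact_uIcc.image_of_continuousOn hf.continuousOn
  have hcd : ContDiffOn ℝ 1 Φ (f '' uIcc a b) := by
    rintro _ ⟨x, hx, rfl⟩
    exact (hΦ x hx).contDiffWithinAt
  obtain ⟨K, hK⟩ := hcd.exists_lipschitzOnWith (by decide) hconv hcomp
  exact ac_lipschitz_comp hf hK (mapsTo_image f _)

/-- A function with a continuous derivative on `[a, b]` is absolutely continuous there. -/
theorem ac_of_hasDerivWithinAt {u p : ℝ → ℝ} {a b : ℝ} (hab : a ≤ b)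
    (hu : ∀ x ∈ Icc a b, HasDerivWithinAt u (p x) (Icc a b) x) (hp : ContinuousOn p (Icc a b)) :
    AbsolutelyContinuousOnInterval u a b := by
  obtain ⟨C, hC⟩ := isCompact_Icc.exists_bound_of_continuousOn hp
  have hL : LipschitzOnWith (Real.toNNReal C) u (Icc a b) := by
    refine (convex_Icc a b).lipschitzOnWith_of_nnnorm_hasDerivWithin_le hu fun x hx => ?_
    rw [← NNReal.coe_le_coe, coe_nnnorm]
    exact (hC x hx).trans (Real.le_coe_toNNReal C)
  rw [← uIcc_of_le hab] at hL
  exact hL.absolutelyContinuousOnInterval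

/-- Linear comparison: if `d' ≤ -c d`, then `d` times the integrating factor is antitone. -/
theorem antitoneOn_mul_exp {d d' c : ℝ → ℝ} {a b : ℝ} (hab : a ≤ b)
    (hd : AbsolutelyContinuousOnInterval d a b)
    (hd' : ∀ᵐ x, x ∈ Ioo a b → HasDerivAt d (d' x) x)
    (hc : ContinuousOn c (Icc a b))
    (hle : ∀ᵐ x, x ∈ Ioo a b → d' x ≤ -(c x * d x)) :
    AntitoneOn (fun x => d x * Real.exp (∫ t in a..x, c t)) (Icc a b) := by
  have hC : ∀ x ∈ Icc a b, HasDerivWithinAt (fun y => ∫ t in a..y, c t) (c x) (Icc a b) x := by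
    intro x hx
    have : Fact (x ∈ Icc a b) := ⟨hx⟩
    refine intervalIntegral.integral_hasDerivWithinAt_right ?_ ?_ (hc x hx)
    · refine (hc.mono ?_).intervalIntegrable
      rw [uIcc_of_le hx.1]; exact Icc_subset_Icc_right hx.2
    · exact hc.stronglyMeasurableAtFilter_nhdsWithin measurableSet_Icc x
  have hCac := ac_of_hasDerivWithinAt hab hC hc
  have hE : AbsolutelyContinuousOnInterval (fun x => Real.exp (∫ t in a..x, c t)) a b :=
    ac_comp (Φ := Real.exp) hCac fun x _ => Real.contDiff_exp.contDiffAt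
  refine ac_antitoneOn (f' := fun x => d' x * Real.exp (∫ t in a..x, c t) +
    d x * (Real.exp (∫ t in a..x, c t) * c x)) (hd.mul hE) ?_ ?_
  · filter_upwards [hd'] with x hx hxm
    have h1 := (hC x (Ioo_subset_Icc_self hxm)).hasDerivAt (Icc_mem_nhds hxm.1 hxm.2)
    exact (hx hxm).mul h1.exp
  · filter_upwards [hle] with x hx hxm
    have h1 := hx hxm
    have h2 := Real.exp_pos (∫ t in a..x, c t)
    nlinarith

theorem nonpos_of_deriv_le {d d' c : ℝ → ℝ} {a b : ℝ}
    (hd : AbsolutelyContinuousOnInterval d a b)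
    (hd' : ∀ᵐ x, x ∈ Ioo a b → HasDerivAt d (d' x) x)
    (hc : ContinuousOn c (Icc a b))
    (hle : ∀ᵐ x, x ∈ Ioo a b → d' x ≤ -(c x * d x)) {s t : ℝ} (hs : a ≤ s) (hst : s ≤ t)
    (ht : t ≤ b) (h : d s ≤ 0) : d t ≤ 0 := by
  have h1 := antitoneOn_mul_exp (hs.trans (hst.trans ht)) hd hd' hc hle ⟨hs, hst.trans ht⟩
    ⟨hs.trans hst, ht⟩ hst
  simp only at h1
  have h2 := Real.exp_pos (∫ x in a..s, c x)
  have h3 := Real.exp_pos (∫ x in a..t, c x)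
  by_contra! h4
  nlinarith [mul_pos h4 h3]

theorem neg_of_deriv_le {d d' c : ℝ → ℝ} {a b : ℝ}
    (hd : AbsolutelyContinuousOnInterval d a b)
    (hd' : ∀ᵐ x, x ∈ Ioo a b → HasDerivAt d (d' x) x)
    (hc : ContinuousOn c (Icc a b))
    (hle : ∀ᵐ x, x ∈ Ioo a b → d' x ≤ -(c x * d x)) {s t : ℝ} (hs : a ≤ s) (hst : s ≤ t)
    (ht : t ≤ b) (h : d s < 0) : d t < 0 := by
  have h1 := antitoneOn_mul_exp (hs.trans (hst.trans ht)) hd hd' hc hle ⟨hs, hst.trans ht⟩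
    ⟨hs.trans hst, ht⟩ hst
  simp only at h1
  have h2 := Real.exp_pos (∫ x in a..s, c x)
  have h3 := Real.exp_pos (∫ x in a..t, c x)
  by_contra! h4
  nlinarith [mul_pos_of_neg_of_neg h (neg_neg_of_pos h2), mul_nonneg h4 h3.le]

/-! ### The Riccati equation -/

/-- `v` is an absolutely continuous solution on `[a, b]` of the Riccati equation `v' = -q - v²`,
the equation satisfied by `v = u' / u` when `u'' + q u = 0` and `u > 0`. -/
structure IsRiccati (a b : ℝ) (q v : ℝ → ℝ) : Prop where
  ac : AbsolutelyContinuousOnInterval v a b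
  deriv : ∀ᵐ x, x ∈ Ioo a b → HasDerivAt v (-q x - v x ^ 2) x

theorem ac_continuousOn {f : ℝ → ℝ} {a b : ℝ} (hab : a ≤ b)
    (hf : AbsolutelyContinuousOnInterval f a b) : ContinuousOn f (Icc a b) := by
  rw [← uIcc_of_le hab]; exact hf.continuousOn

theorem ac_const (c a b : ℝ) : AbsolutelyContinuousOnInterval (fun _ : ℝ => c) a b :=
  (contDiff_const.contDiffOn (n := 1)).absolutelyContinuousOnInterval

theorem IsRiccati.mono {a b p q : ℝ} {w v : ℝ → ℝ} (h : IsRiccati a b w v) (hap : a ≤ p)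
    (hpq : p ≤ q) (hqb : q ≤ b) : IsRiccati p q w v :=
  ⟨ac_mono h.ac hap hpq hqb, h.deriv.mono fun _ hx hxm => hx (Ioo_subset_Ioo hap hqb hxm)⟩

/-- The Riccati variable of a positive solution of the linear equation. -/
theorem isRiccati_div {a b : ℝ} {q u p : ℝ → ℝ} (hab : a ≤ b)
    (hpos : ∀ x ∈ Icc a b, 0 < u x)
    (hu : ∀ x ∈ Icc a b, HasDerivWithinAt u (p x) (Icc a b) x)
    (hp : AbsolutelyContinuousOnInterval p a b)
    (he : ∀ᵐ x, x ∈ Ioo a b → HasDerivAt p (-(q x * u x)) x) :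
    IsRiccati a b q (fun x => p x / u x) := by
  have huac := ac_of_hasDerivWithinAt hab hu (ac_continuousOn hab hp)
  refine ⟨?_, ?_⟩
  · have h1 : AbsolutelyContinuousOnInterval (fun x => (u x)⁻¹) a b := by
      refine ac_comp (Φ := fun y => y⁻¹) huac fun x hx => ?_
      rw [uIcc_of_le hab] at hx
      exact contDiffAt_inv ℝ (hpos x hx).ne'
    exact hp.mul h1
  · filter_upwards [he] with x hx hxm
    have hxI := Ioo_subset_Icc_self hxm
    have h1 := (hu x hxI).hasDerivAt (Icc_mem_nhds hxm.1 hxm.2)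
    have h2 := (hpos x hxI).ne'
    refine ((hx hxm).div h1 h2).congr_deriv ?_
    field_simp

section Barrier

variable {a b lam R s t : ℝ} {q v : ℝ → ℝ}

theorem IsRiccati.hasDerivAt_sub_const (h : IsRiccati a b q v) (R : ℝ) :
    ∀ᵐ x, x ∈ Ioo a b → HasDerivAt (fun y => v y - R) (-q x - v x ^ 2) x :=
  h.deriv.mono fun _ hx hxm => (hx hxm).sub_const R

theorem IsRiccati.deriv_sub_le (hq : ∀ᵐ x, x ∈ Ioo a b → -q x ≤ lam) (hR : lam ≤ R ^ 2) :
    ∀ᵐ x, x ∈ Ioo a b → -q x - v x ^ 2 ≤ -((v x + R) * (v x - R)) := by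
  filter_upwards [hq] with x hx hxm
  nlinarith [hx hxm]

theorem IsRiccati.le_of_le (h : IsRiccati a b q v)
    (hq : ∀ᵐ x, x ∈ Ioo a b → -q x ≤ lam) (hR : lam ≤ R ^ 2)
    (hs : a ≤ s) (hst : s ≤ t) (ht : t ≤ b) (hv : v s ≤ R) : v t ≤ R := by
  have hab := hs.trans (hst.trans ht)
  have := nonpos_of_deriv_le (h.ac.sub (ac_const R a b)) (h.hasDerivAt_sub_const R)
    ((ac_continuousOn hab h.ac).add continuousOn_const) (IsRiccati.deriv_sub_le hq hR) hs hst ht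
    (by simpa using hv)
  simpa using this

theorem IsRiccati.lt_of_lt (h : IsRiccati a b q v)
    (hq : ∀ᵐ x, x ∈ Ioo a b → -q x ≤ lam) (hR : lam ≤ R ^ 2)
    (hs : a ≤ s) (hst : s ≤ t) (ht : t ≤ b) (hv : v s < R) : v t < R := by
  have hab := hs.trans (hst.trans ht)
  have := neg_of_deriv_le (h.ac.sub (ac_const R a b)) (h.hasDerivAt_sub_const R)
    ((ac_continuousOn hab h.ac).add continuousOn_const) (IsRiccati.deriv_sub_le hq hR) hs hst ht
    (by simpa using hv)
  simpa using this

theorem IsRiccati.ge_of_ge (h : IsRiccati a b q v)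
    (hq : ∀ᵐ x, x ∈ Ioo a b → lam ≤ -q x) (hR : R ^ 2 ≤ lam)
    (hs : a ≤ s) (hst : s ≤ t) (ht : t ≤ b) (hv : R ≤ v s) : R ≤ v t := by
  have hab := hs.trans (hst.trans ht)
  have := nonpos_of_deriv_le (h.ac.sub (ac_const R a b)).neg
    ((h.hasDerivAt_sub_const R).mono fun x hx hxm => (hx hxm).neg)
    ((ac_continuousOn hab h.ac).add (continuousOn_const (c := R))) (by
      filter_upwards [hq] with x hx hxm
      simp only [Pi.neg_apply, Pi.sub_apply, Pi.add_apply]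
      nlinarith [hx hxm]) hs hst ht (by simpa using hv)
  simpa using this

theorem IsRiccati.gt_of_gt (h : IsRiccati a b q v)
    (hq : ∀ᵐ x, x ∈ Ioo a b → lam ≤ -q x) (hR : R ^ 2 ≤ lam)
    (hs : a ≤ s) (hst : s ≤ t) (ht : t ≤ b) (hv : R < v s) : R < v t := by
  have hab := hs.trans (hst.trans ht)
  have := neg_of_deriv_le (h.ac.sub (ac_const R a b)).neg
    ((h.hasDerivAt_sub_const R).mono fun x hx hxm => (hx hxm).neg)
    ((ac_continuousOn hab h.ac).add (continuousOn_const (c := R))) (by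
      filter_upwards [hq] with x hx hxm
      simp only [Pi.neg_apply, Pi.sub_apply, Pi.add_apply]
      nlinarith [hx hxm]) hs hst ht (by simpa using hv)
  simpa using this

/-- A solution cannot rest at a level at which the right-hand side is negative. -/
theorem IsRiccati.not_const (h : IsRiccati a b q v)
    (hq : ∀ᵐ x, x ∈ Ioo a b → -q x ≤ lam) (hR : lam < R ^ 2)
    (hs : a ≤ s) (hst : s < t) (ht : t ≤ b) (hv : ∀ x ∈ Ioo s t, v x = R) : False := by
  obtain ⟨x, hx, h1, h2⟩ := exists_mem_Ioo_of_ae hst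
    (P := fun x => HasDerivAt v (-q x - v x ^ 2) x ∧ -q x ≤ lam) (by
      filter_upwards [h.deriv, hq] with x h1 h2 hx
      have := Ioo_subset_Ioo hs ht hx
      exact ⟨h1 this, h2 this⟩)
  have h3 := hasDerivAt_zero_of_const hx hv h1
  rw [hv x hx] at h3
  linarith

theorem IsRiccati.lt_of_eq (h : IsRiccati a b q v)
    (hq : ∀ᵐ x, x ∈ Ioo a b → -q x ≤ lam) (hR : lam < R ^ 2)
    (hs : a ≤ s) (hst : s < t) (ht : t ≤ b) (hv : v s ≤ R) : v t < R := by
  have hle := h.le_of_le hq hR.le hs hst.le ht hv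
  refine lt_of_le_of_ne hle fun heq => h.not_const hq hR hs hst ht fun x hx => ?_
  refine le_antisymm (h.le_of_le hq hR.le hs hx.1.le (hx.2.le.trans ht) hv) ?_
  by_contra! hlt
  have := h.lt_of_lt hq hR.le (hs.trans hx.1.le) hx.2.le ht hlt
  linarith

end Barrier

/-! ### Calibrations -/

theorem IsRiccati.integral_comp {a b : ℝ} {q v Φ φ : ℝ → ℝ} (hab : a ≤ b)
    (h : IsRiccati a b q v)
    (hΦ : ∀ x ∈ Icc a b, ContDiffAt ℝ 1 Φ (v x) ∧ HasDerivAt Φ (φ (v x)) (v x)) :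
    IntervalIntegrable (fun x => φ (v x) * (-q x - v x ^ 2)) volume a b ∧
      ∫ x in a..b, φ (v x) * (-q x - v x ^ 2) = Φ (v b) - Φ (v a) := by
  refine ac_integral_eq_sub (f := fun x => Φ (v x)) hab (ac_comp h.ac fun x hx => ?_) ?_
  · rw [uIcc_of_le hab] at hx
    exact (hΦ x hx).1
  · filter_upwards [h.deriv] with x hx hxm
    exact (hΦ x (Ioo_subset_Icc_self hxm)).2.comp x (hx hxm)

/-- The calibration inequality: a running cost that dominates `-(Φ ∘ v)'` integrates to at least
the total decrease of `Φ ∘ v`, with equality only if it coincides with `-(Φ ∘ v)'`. -/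
theorem IsRiccati.calibration {a b : ℝ} {q v Φ φ g : ℝ → ℝ} (hab : a ≤ b)
    (h : IsRiccati a b q v)
    (hΦ : ∀ x ∈ Icc a b, ContDiffAt ℝ 1 Φ (v x) ∧ HasDerivAt Φ (φ (v x)) (v x))
    (hg : IntervalIntegrable g volume a b)
    (hle : ∀ᵐ x, x ∈ Ioo a b → 0 ≤ g x + φ (v x) * (-q x - v x ^ 2)) :
    Φ (v a) - Φ (v b) ≤ ∫ x in a..b, g x ∧
      (∫ x in a..b, g x ≤ Φ (v a) - Φ (v b) →
        ∀ᵐ x, x ∈ Ioo a b → g x + φ (v x) * (-q x - v x ^ 2) = 0) := by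
  obtain ⟨h1, h2⟩ := h.integral_comp hab hΦ
  have h3 := intervalIntegral.integral_add hg h1
  rw [h2] at h3
  have hle' : 0 ≤ᵐ[volume.restrict (Ioo a b)] fun x => g x + φ (v x) * (-q x - v x ^ 2) := by
    rw [Filter.EventuallyLE, ae_restrict_iff' measurableSet_Ioo]
    exact hle
  rw [intervalIntegral.integral_of_le hab (f := fun x => g x + _),
    integral_Ioc_eq_integral_Ioo] at h3
  have h4 := setIntegral_nonneg_of_ae_restrict hle'
  refine ⟨by linarith, fun heq => ?_⟩
  have h5 : ∫ x in Ioo a b, g x + φ (v x) * (-q x - v x ^ 2) = 0 := by linarith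
  have hint : IntegrableOn (fun x => g x + φ (v x) * (-q x - v x ^ 2)) (Ioo a b) :=
    ((hg.add h1).1).mono_set Ioo_subset_Ioc_self
  have h6 := (setIntegral_eq_zero_iff_of_nonneg_ae hle' hint).1 h5
  rwa [Filter.EventuallyEq, ae_restrict_iff' measurableSet_Ioo] at h6

/-- A primitive of `1 / (y² + lam κ)`: differences of it are the times that the descent
`v' = -(v² + lam κ)` takes between two levels. -/
noncomputable def descentTime (lam κ y : ℝ) : ℝ := Real.arctan (y / √(lam * κ)) / √(lam * κ)

/-- A primitive of `1 / (lam - y²)` away from `y² = lam`: differences of it are the times that the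
flow `v' = lam - v²` takes between two levels. -/
noncomputable def coastTime (lam y : ℝ) : ℝ :=
  (Real.log (√lam + y) - Real.log (√lam - y)) / (2 * √lam)

theorem descentTime_neg (lam κ y : ℝ) : descentTime lam κ (-y) = -descentTime lam κ y := by
  simp [descentTime, neg_div, Real.arctan_neg]

theorem coastTime_neg (lam y : ℝ) : coastTime lam (-y) = -coastTime lam y := by
  simp only [coastTime, sub_neg_eq_add, ← sub_eq_add_neg]
  ring

theorem descentTime_spec {lam κ : ℝ} (h : 0 < lam * κ) (y : ℝ) :
    ContDiffAt ℝ 1 (descentTime lam κ) y ∧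
      HasDerivAt (descentTime lam κ) (1 / (y ^ 2 + lam * κ)) y := by
  have hs := Real.sqrt_pos.2 h
  have hsq := Real.sq_sqrt h.le
  refine ⟨?_, ?_⟩
  · unfold descentTime
    exact (Real.contDiff_arctan.comp (contDiff_id.div_const _)).div_const _ |>.contDiffAt
  · have := (((hasDerivAt_id y).div_const (√(lam * κ))).arctan).div_const (√(lam * κ))
    refine this.congr_deriv ?_
    have h2 : y ^ 2 + lam * κ ≠ 0 := by positivity
    have h3 : 1 + (y / √(lam * κ)) ^ 2 = (y ^ 2 + lam * κ) / (lam * κ) := by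
      rw [div_pow, hsq, add_div, div_self h.ne', add_comm]
    simp only [id]
    rw [h3]
    field_simp
    rw [hsq]

theorem coastTime_spec {lam : ℝ} (h : 0 < lam) {y : ℝ} (hy : y ^ 2 ≠ lam) :
    ContDiffAt ℝ 1 (coastTime lam) y ∧ HasDerivAt (coastTime lam) (1 / (lam - y ^ 2)) y := by
  have hs := Real.sqrt_pos.2 h
  have hsq := Real.sq_sqrt h.le
  have h1 : √lam + y ≠ 0 := fun h0 => hy (by rw [← hsq]; linear_combination (y - √lam) * h0)
  have h2 : √lam - y ≠ 0 := fun h0 => hy (by rw [← hsq]; linear_combination (-y - √lam) * h0)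
  have h3 : lam - y ^ 2 = (√lam + y) * (√lam - y) := by linear_combination -hsq
  refine ⟨?_, ?_⟩
  · unfold coastTime
    refine ContDiffAt.div_const (ContDiffAt.sub ?_ ?_) _
    · exact (contDiffAt_const.add contDiffAt_id).log h1
    · exact (contDiffAt_const.sub contDiffAt_id).log h2
  · have := ((((hasDerivAt_id y).const_add (√lam)).log h1).sub
      (((hasDerivAt_id y).const_sub (√lam)).log h2)).div_const (2 * √lam)
    refine this.congr_deriv ?_
    simp only [id]
    rw [h3]
    field_simp
    ring

theorem strictMono_descentTime {lam κ : ℝ} (h : 0 < lam * κ) :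
    StrictMono (descentTime lam κ) := by
  refine strictMono_of_deriv_pos fun y => ?_
  rw [(descentTime_spec h y).2.deriv]
  positivity

theorem strictMonoOn_coastTime {lam : ℝ} (h : 0 < lam) :
    StrictMonoOn (coastTime lam) (Ioo (-√lam) (√lam)) := by
  have hne : ∀ y ∈ Ioo (-√lam) (√lam), y ^ 2 < lam := fun y hy => by
    rw [← Real.sq_sqrt h.le]; exact sq_lt_sq' hy.1 hy.2
  refine strictMonoOn_of_deriv_pos (convex_Ioo _ _) (fun y hy =>
    (coastTime_spec h (hne y hy).ne).1.continuousAt.continuousWithinAt) fun y hy => ?_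
  rw [interior_Ioo] at hy
  rw [(coastTime_spec h (hne y hy).ne).2.deriv]
  have := hne y hy
  exact one_div_pos.2 (by linarith)

theorem strictAntiOn_coastTime {lam : ℝ} (h : 0 < lam) :
    StrictAntiOn (coastTime lam) (Ioi (√lam)) := by
  have hne : ∀ y ∈ Ioi (√lam), lam < y ^ 2 := fun y hy => by
    rw [← Real.sq_sqrt h.le]; exact pow_lt_pow_left₀ hy (Real.sqrt_nonneg _) two_ne_zero
  refine strictAntiOn_of_deriv_neg (convex_Ioi _) (fun y hy =>
    (coastTime_spec h (hne y hy).ne').1.continuousAt.continuousWithinAt) fun y hy => ?_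
  rw [interior_Ioi] at hy
  rw [(coastTime_spec h (hne y hy).ne').2.deriv]
  have := hne y hy
  exact one_div_neg.2 (by linarith)

/-! ### The controlled Riccati equation -/

/-- The Riccati equation for the weight `(1 + κ) θ - 1` at spectral parameter `lam`, viewed as a
control system with control `θ ∈ [0, 1]`: for `θ = 0` the state follows `v' = lam - v²`, for
`θ = 1` it follows `v' = -(v² + lam κ)`. -/
structure IsControlled (a b lam κ : ℝ) (θ v : ℝ → ℝ) : Prop where
  riccati : IsRiccati a b (fun x => lam * ((1 + κ) * θ x - 1)) v
  range : ∀ᵐ x, x ∈ Ioo a b → 0 ≤ θ x ∧ θ x ≤ 1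
  integrable : IntervalIntegrable θ volume a b

section

variable {a b lam κ : ℝ} {θ v : ℝ → ℝ}

theorem IsControlled.mono {p q : ℝ} (h : IsControlled a b lam κ θ v) (hap : a ≤ p)
    (hpq : p ≤ q) (hqb : q ≤ b) : IsControlled p q lam κ θ v :=
  ⟨h.riccati.mono hap hpq hqb, h.range.mono fun _ hx hxm => hx (Ioo_subset_Ioo hap hqb hxm),
    h.integrable.mono_set (by
      rw [uIcc_of_le hpq, uIcc_of_le (hap.trans (hpq.trans hqb))]
      exact Icc_subset_Icc hap hqb)⟩

theorem IsControlled.neg_le (h : IsControlled a b lam κ θ v) (hl : 0 < lam) (hκ : 0 < κ) :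
    ∀ᵐ x, x ∈ Ioo a b → -(lam * ((1 + κ) * θ x - 1)) ≤ lam := by
  filter_upwards [h.range] with x hx hxm
  have := mul_nonneg (mul_nonneg hl.le (by linarith : 0 ≤ 1 + κ)) (hx hxm).1
  nlinarith

theorem IsControlled.continuousOn (h : IsControlled a b lam κ θ v) (hab : a ≤ b) :
    ContinuousOn v (Icc a b) := ac_continuousOn hab h.riccati.ac

theorem IsControlled.integral_add (h : IsControlled a b lam κ θ v) {t : ℝ} (hat : a ≤ t)
    (htb : t ≤ b) : (∫ x in a..t, θ x) + ∫ x in t..b, θ x = ∫ x in a..b, θ x :=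
  intervalIntegral.integral_add_adjacent_intervals (h.mono le_rfl hat htb).integrable
    (h.mono hat htb le_rfl).integrable

/-- Calibration by `K * coastTime`, where `K = (lam - V²) / (lam (1 + κ))`. For this multiplier,
`θ - K + K v' / (lam - v²) = θ (1 - (lam - V²) / (lam - v²))`, which is nonnegative and vanishes
only where the state coasts or sits at the levels `±V`. -/
theorem IsControlled.coast_le (h : IsControlled a b lam κ θ v) (hab : a ≤ b) (hl : 0 < lam)
    {V K : ℝ} (hK : K * (lam * (1 + κ)) = lam - V ^ 2)
    (hv : ∀ x ∈ Icc a b, v x ^ 2 ≠ lam ∧ (lam - V ^ 2) / (lam - v x ^ 2) ≤ 1) :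
    K * (b - a) - K * (coastTime lam (v b) - coastTime lam (v a)) ≤ ∫ x in a..b, θ x ∧
      (∫ x in a..b, θ x ≤ K * (b - a) - K * (coastTime lam (v b) - coastTime lam (v a)) →
        ∀ᵐ x, x ∈ Ioo a b → θ x = 0 ∨ v x ^ 2 = V ^ 2) := by
  have hid : ∀ x ∈ Ioo a b, (θ x - K) + (K * (1 / (lam - v x ^ 2))) *
      (-(lam * ((1 + κ) * θ x - 1)) - v x ^ 2) =
      θ x * (1 - (lam - V ^ 2) / (lam - v x ^ 2)) := by
    intro x hx
    have h1 : lam - v x ^ 2 ≠ 0 := sub_ne_zero.2 (hv x (Ioo_subset_Icc_self hx)).1.symm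
    rw [← hK]
    field_simp
    ring
  have hc := h.riccati.calibration hab (Φ := fun y => K * coastTime lam y)
    (φ := fun y => K * (1 / (lam - y ^ 2))) (g := fun x => θ x - K)
    (fun x hx => ⟨contDiffAt_const.mul (coastTime_spec hl (hv x hx).1).1,
      (coastTime_spec hl (hv x hx).1).2.const_mul K⟩)
    (h.integrable.sub intervalIntegrable_const) (by
      filter_upwards [h.range] with x hx hxm
      rw [hid x hxm]
      exact mul_nonneg (hx hxm).1 (sub_nonneg.2 (hv x (Ioo_subset_Icc_self hxm)).2))
  have hi : ∫ x in a..b, (θ x - K) = (∫ x in a..b, θ x) - K * (b - a) := by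
    rw [intervalIntegral.integral_sub h.integrable intervalIntegrable_const]
    simp [mul_comm]
  rw [hi] at hc
  refine ⟨by linarith [hc.1], fun hle => ?_⟩
  filter_upwards [hc.2 (by linarith)] with x hx hxm
  have h2 := hx hxm
  rw [hid x hxm] at h2
  rcases mul_eq_zero.1 h2 with h3 | h3
  · exact Or.inl h3
  · right
    have h1 : lam - v x ^ 2 ≠ 0 := sub_ne_zero.2 (hv x (Ioo_subset_Icc_self hxm)).1.symm
    have h4 := (div_eq_one_iff_eq h1).1 (sub_eq_zero.1 h3).symm
    linarith

/-- Calibration by `(1 - K) * descentTime`, where `K = (lam - V²) / (lam (1 + κ))` and hence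
`1 - K = (V² + lam κ) / (lam (1 + κ))`. For this multiplier,
`θ - K + (1 - K) v' / (v² + lam κ) = (1 - θ) (V² - v²) / (v² + lam κ)`, which is nonnegative and
vanishes only where the state descends or sits at the levels `±V`. -/
theorem IsControlled.descent_le (h : IsControlled a b lam κ θ v) (hab : a ≤ b) (hl : 0 < lam)
    (hκ : 0 < κ) {V K : ℝ} (hK : K * (lam * (1 + κ)) = lam - V ^ 2)
    (hv : ∀ x ∈ Icc a b, v x ^ 2 ≤ V ^ 2) :
    K * (b - a) + (1 - K) * (descentTime lam κ (v a) - descentTime lam κ (v b)) ≤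
        ∫ x in a..b, θ x ∧
      (∫ x in a..b, θ x ≤
          K * (b - a) + (1 - K) * (descentTime lam κ (v a) - descentTime lam κ (v b)) →
        ∀ᵐ x, x ∈ Ioo a b → θ x = 1 ∨ v x ^ 2 = V ^ 2) := by
  have hlk := mul_pos hl hκ
  have hid : ∀ x ∈ Ioo a b, (θ x - K) + ((1 - K) * (1 / (v x ^ 2 + lam * κ))) *
      (-(lam * ((1 + κ) * θ x - 1)) - v x ^ 2) =
      (1 - θ x) * ((V ^ 2 - v x ^ 2) / (v x ^ 2 + lam * κ)) := by
    intro x hx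
    have h1 : v x ^ 2 + lam * κ ≠ 0 := by positivity
    have h2 : V ^ 2 = lam - K * (lam * (1 + κ)) := by linarith
    rw [h2]
    field_simp
    ring
  have hc := h.riccati.calibration hab (Φ := fun y => (1 - K) * descentTime lam κ y)
    (φ := fun y => (1 - K) * (1 / (y ^ 2 + lam * κ))) (g := fun x => θ x - K)
    (fun x hx => ⟨contDiffAt_const.mul (descentTime_spec hlk _).1,
      (descentTime_spec hlk _).2.const_mul (1 - K)⟩)
    (h.integrable.sub intervalIntegrable_const) (by
      filter_upwards [h.range] with x hx hxm
      rw [hid x hxm]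
      have := hv x (Ioo_subset_Icc_self hxm)
      exact mul_nonneg (sub_nonneg.2 (hx hxm).2) (div_nonneg (by linarith) (by positivity)))
  have hi : ∫ x in a..b, (θ x - K) = (∫ x in a..b, θ x) - K * (b - a) := by
    rw [intervalIntegral.integral_sub h.integrable intervalIntegrable_const]
    simp [mul_comm]
  rw [hi] at hc
  refine ⟨by linarith [hc.1], fun hle => ?_⟩
  filter_upwards [hc.2 (by linarith)] with x hx hxm
  have h2 := hx hxm
  rw [hid x hxm] at h2
  rcases mul_eq_zero.1 h2 with h3 | h3
  · left; linarith
  · right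
    have h1 : v x ^ 2 + lam * κ ≠ 0 := by positivity
    rcases div_eq_zero_iff.1 h3 with h4 | h4
    · linarith
    · exact absurd h4 h1

/-- A phase with vanishing control lasts for the increase of `coastTime`. -/
theorem IsControlled.coast_eq (h : IsControlled a b lam κ θ v) (hab : a ≤ b) (hl : 0 < lam)
    (hv : ∀ x ∈ Icc a b, v x ^ 2 ≠ lam) (hθ : ∀ᵐ x, x ∈ Ioo a b → θ x = 0) :
    coastTime lam (v b) - coastTime lam (v a) = b - a := by
  have h1 := (h.riccati.integral_comp hab (Φ := coastTime lam) (φ := fun y => 1 / (lam - y ^ 2))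
    fun x hx => coastTime_spec hl (hv x hx)).2
  rw [← h1, intervalIntegral.integral_of_le hab, integral_Ioc_eq_integral_Ioo,
    setIntegral_congr_ae measurableSet_Ioo (g := fun _ => (1 : ℝ))]
  · simp [hab]
  · filter_upwards [hθ] with x hx hxm
    have h2 : lam - v x ^ 2 ≠ 0 := sub_ne_zero.2 (hv x (Ioo_subset_Icc_self hxm)).symm
    rw [hx hxm]
    field_simp
    ring

/-- A phase with full control lasts for the decrease of `descentTime`. -/
theorem IsControlled.descent_eq (h : IsControlled a b lam κ θ v) (hab : a ≤ b) (hl : 0 < lam)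
    (hκ : 0 < κ) (hθ : ∀ᵐ x, x ∈ Ioo a b → θ x = 1) :
    descentTime lam κ (v a) - descentTime lam κ (v b) = b - a := by
  have hlk := mul_pos hl hκ
  have h1 := (h.riccati.integral_comp hab (Φ := descentTime lam κ)
    (φ := fun y => 1 / (y ^ 2 + lam * κ)) fun x hx => descentTime_spec hlk _).2
  rw [← neg_inj, neg_sub, ← h1, intervalIntegral.integral_of_le hab, integral_Ioc_eq_integral_Ioo,
    setIntegral_congr_ae measurableSet_Ioo (g := fun _ => (-1 : ℝ))]
  · simp [hab]
  · filter_upwards [hθ] with x hx hxm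
    have h2 : v x ^ 2 + lam * κ ≠ 0 := by positivity
    rw [hx hxm]
    field_simp
    ring

end

/-! ### First and last hitting times -/

theorem exists_first_time {v : ℝ → ℝ} {a b V : ℝ} (hab : a ≤ b) (hv : ContinuousOn v (Icc a b))
    (ha : V ≤ v a) (hb : v b ≤ V) :
    ∃ t ∈ Icc a b, v t = V ∧ ∀ x ∈ Ico a t, V < v x := by
  have hne : (Icc a b ∩ v ⁻¹' Iic V).Nonempty := ⟨b, right_mem_Icc.2 hab, hb⟩
  have hc : IsCompact (Icc a b ∩ v ⁻¹' Iic V) :=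
    isCompact_Icc.of_isClosed_subset (hv.preimage_isClosed_of_isClosed isClosed_Icc isClosed_Iic)
      inter_subset_left
  obtain ⟨t, ⟨ht, htV⟩, hmin⟩ := hc.exists_isLeast hne
  have hlt : ∀ x ∈ Ico a t, V < v x := fun x hx => by
    by_contra! hle
    exact (hmin ⟨⟨hx.1, hx.2.le.trans ht.2⟩, hle⟩).not_gt hx.2
  refine ⟨t, ht, le_antisymm htV ?_, hlt⟩
  -- the intermediate value theorem on `[a, t]` produces a point that cannot precede `t`
  obtain ⟨x, hx, hxV⟩ := intermediate_value_Icc' ht.1 (hv.mono (Icc_subset_Icc_right ht.2))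
    ⟨htV, ha⟩
  rcases hx.2.eq_or_lt with h | h
  · rw [← h, hxV]
  · exact absurd hxV (hlt x ⟨hx.1, h⟩).ne'

theorem exists_last_time {v : ℝ → ℝ} {a b V : ℝ} (hab : a ≤ b) (hv : ContinuousOn v (Icc a b))
    (ha : V ≤ v a) (hb : v b ≤ V) :
    ∃ t ∈ Icc a b, v t = V ∧ ∀ x ∈ Ioc t b, v x < V := by
  have hv' : ContinuousOn (fun x => -v (-x)) (Icc (-b) (-a)) :=
    (hv.comp continuousOn_neg fun x hx => ⟨by linarith [hx.2], by linarith [hx.1]⟩).neg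
  obtain ⟨t, ht, htV, hlt⟩ := exists_first_time (V := -V) (neg_le_neg hab) hv'
    (by simpa using hb) (by simpa using ha)
  refine ⟨-t, ⟨by linarith [ht.2], by linarith [ht.1]⟩, by linarith, fun x hx => ?_⟩
  have := hlt (-x) ⟨by linarith [hx.2], by linarith [hx.1]⟩
  rw [neg_neg] at this
  linarith

theorem ae_eq_indicator_of_pieces {θ : ℝ → ℝ} {a b s t : ℝ}
    (h1 : ∀ᵐ x, x ∈ Ioo a s → θ x = 0) (h2 : ∀ᵐ x, x ∈ Ioo s t → θ x = 1)
    (h3 : ∀ᵐ x, x ∈ Ioo t b → θ x = 0) :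
    ∀ᵐ x, x ∈ Ioo a b → θ x = (Ioo s t).indicator 1 x := by
  have hs : ∀ᵐ x : ℝ, x ≠ s := by simp [ae_iff, measure_singleton]
  have ht : ∀ᵐ x : ℝ, x ≠ t := by simp [ae_iff, measure_singleton]
  filter_upwards [h1, h2, h3, hs, ht] with x h1 h2 h3 hs ht hx
  by_cases hm : x ∈ Ioo s t
  · rw [indicator_of_mem hm, h2 hm, Pi.one_apply]
  · rw [indicator_of_notMem hm]
    rcases lt_or_gt_of_ne hs with h | h
    · exact h1 ⟨hx.1, h⟩
    · exact h3 ⟨lt_of_le_of_ne (not_lt.1 fun h' => hm ⟨h, h'⟩) ht.symm, hx.2⟩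

/-! ### Minimal control at a fixed spectral parameter -/

section

variable {a b lam κ β : ℝ} {θ v : ℝ → ℝ}

/-- For `lam < β²` the cheapest control is centred: the state coasts down from `β` to the level
`V`, descends to `-V`, and coasts to `-β`. -/
theorem IsControlled.le_integral_of_lt_sq (h : IsControlled a b lam κ θ v) (hab : a ≤ b)
    (hl : 0 < lam) (hκ : 0 < κ) (hva : v a = β) (hvb : v b = -β) {V τ l : ℝ} (hV : √lam < V)
    (hVβ : V ≤ β) (hτ : coastTime lam V - coastTime lam β = τ) (hl2 : 2 * descentTime lam κ V = l)
    (hL : 2 * τ + l = b - a) :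
    l ≤ ∫ x in a..b, θ x ∧ (∫ x in a..b, θ x ≤ l →
      ∀ᵐ x, x ∈ Ioo a b → θ x = (Ioo (a + τ) (b - τ)).indicator 1 x) := by
  have hs := Real.sqrt_nonneg lam
  have hVl : lam < V ^ 2 := by
    rw [← Real.sq_sqrt hl.le]; exact pow_lt_pow_left₀ hV hs two_ne_zero
  have hV0 : 0 < V := hs.trans_lt hV
  have hq := h.neg_le hl hκ
  have hcont := h.continuousOn hab
  have hVl' : lam < (-V) ^ 2 := by rwa [neg_sq]
  obtain ⟨t1, ht1, hv1, hlt1⟩ := exists_first_time hab hcont (V := V) (by linarith) (by linarith)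
  obtain ⟨t2, ht2, hv2, hlt2⟩ := exists_last_time hab hcont (V := -V) (by linarith) (by linarith)
  have h12 : t1 ≤ t2 := by
    by_contra! hc
    have := hlt2 t1 ⟨hc, ht1.2⟩
    linarith
  have hup : ∀ x ∈ Ioc t1 b, v x < V := fun x hx =>
    h.riccati.lt_of_eq hq hVl ht1.1 hx.1 hx.2 hv1.le
  have hlow : ∀ x ∈ Ico a t2, -V < v x := fun x hx => by
    by_contra! hle
    have := h.riccati.lt_of_eq hq hVl' hx.1 hx.2 ht2.2 hle
    linarith
  have hge : ∀ x ∈ Icc a t1, V ≤ v x := fun x hx => by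
    rcases hx.2.eq_or_lt with h' | h'
    · rw [h', hv1]
    · exact (hlt1 x ⟨hx.1, h'⟩).le
  have hle : ∀ x ∈ Icc t2 b, v x ≤ -V := fun x hx => by
    rcases hx.1.eq_or_lt with h' | h'
    · rw [← h', hv2]
    · exact (hlt2 x ⟨h', hx.2⟩).le
  have hmid : ∀ x ∈ Icc t1 t2, v x ^ 2 ≤ V ^ 2 := fun x hx => by
    refine sq_le_sq' ?_ ?_
    · rcases hx.2.eq_or_lt with h' | h'
      · rw [h', hv2]
      · exact (hlow x ⟨ht1.1.trans hx.1, h'⟩).le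
    · rcases hx.1.eq_or_lt with h' | h'
      · rw [← h', hv1]
      · exact (hup x ⟨h', hx.2.trans ht2.2⟩).le
  obtain ⟨K, hK⟩ : ∃ K, K * (lam * (1 + κ)) = lam - V ^ 2 :=
    ⟨(lam - V ^ 2) / (lam * (1 + κ)), by field_simp⟩
  have hcond : ∀ y : ℝ, V ^ 2 ≤ y ^ 2 → y ^ 2 ≠ lam ∧ (lam - V ^ 2) / (lam - y ^ 2) ≤ 1 := by
    intro y hy
    refine ⟨by intro h0; linarith, ?_⟩
    rw [div_le_one_of_neg (by linarith)]
    linarith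
  have hsq1 : ∀ x ∈ Icc a t1, V ^ 2 ≤ v x ^ 2 := fun x hx =>
    pow_le_pow_left₀ hV0.le (hge x hx) 2
  have hsq2 : ∀ x ∈ Icc t2 b, V ^ 2 ≤ v x ^ 2 := fun x hx => by
    nlinarith [hle x hx]
  have hc1 := h.mono le_rfl ht1.1 ht1.2
  have hc2 := h.mono ht1.1 h12 ht2.2
  have hc3 := h.mono ht2.1 ht2.2 le_rfl
  obtain ⟨e1, f1⟩ := hc1.coast_le ht1.1 hl hK fun x hx => hcond _ (hsq1 x hx)
  obtain ⟨e2, f2⟩ := hc2.descent_le h12 hl hκ hK hmid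
  obtain ⟨e3, f3⟩ := hc3.coast_le ht2.2 hl hK fun x hx => hcond _ (hsq2 x hx)
  have hsum := h.integral_add ht1.1 ht1.2
  have hsum2 := (h.mono ht1.1 ht1.2 le_rfl).integral_add h12 ht2.2
  rw [hva, hv1, hτ] at e1 f1
  rw [hv1, hv2, descentTime_neg, sub_neg_eq_add, ← two_mul, hl2] at e2 f2
  rw [hvb, hv2, coastTime_neg, coastTime_neg,
    show -coastTime lam β - -coastTime lam V = τ by linarith] at e3 f3
  -- the three calibrations share the multiplier `K`, so the unknown times `t1`, `t2` cancel
  have htot : K * (t1 - a) - K * τ + (K * (t2 - t1) + (1 - K) * l) + (K * (b - t2) - K * τ) = l := by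
    linear_combination K * (-hL)
  refine ⟨by linarith, fun hle' => ?_⟩
  have z1 : ∀ᵐ x, x ∈ Ioo a t1 → θ x = 0 := by
    filter_upwards [f1 (by linarith)] with x hx hxm
    refine (hx hxm).resolve_right ?_
    have := hlt1 x ⟨hxm.1.le, hxm.2⟩
    exact (pow_lt_pow_left₀ this hV0.le two_ne_zero).ne'
  have z2 : ∀ᵐ x, x ∈ Ioo t1 t2 → θ x = 1 := by
    filter_upwards [f2 (by linarith)] with x hx hxm
    refine (hx hxm).resolve_right ?_
    exact (sq_lt_sq' (hlow x ⟨ht1.1.trans hxm.1.le, hxm.2⟩)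
      (hup x ⟨hxm.1, hxm.2.le.trans ht2.2⟩)).ne
  have z3 : ∀ᵐ x, x ∈ Ioo t2 b → θ x = 0 := by
    filter_upwards [f3 (by linarith)] with x hx hxm
    refine (hx hxm).resolve_right ?_
    have := hlt2 x ⟨hxm.1, hxm.2.le⟩
    nlinarith
  have g1 := hc1.coast_eq ht1.1 hl (fun x hx => (hcond _ (hsq1 x hx)).1) z1
  have g2 := hc2.descent_eq h12 hl hκ z2
  rw [hva, hv1, hτ] at g1
  rw [hv1, hv2, descentTime_neg, sub_neg_eq_add, ← two_mul, hl2] at g2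
  have k1 : a + τ = t1 := by linarith
  have k2 : b - τ = t2 := by linarith
  rw [k1, k2]
  exact ae_eq_indicator_of_pieces z1 z2 z3

/-- For `lam = β²` the state can rest at `±β`, and every interval of the right length is
optimal. -/
theorem IsControlled.le_integral_of_eq_sq (h : IsControlled a b lam κ θ v) (hab : a ≤ b)
    (hl : 0 < lam) (hκ : 0 < κ) (hβ : 0 < β) (hlβ : lam = β ^ 2) (hva : v a = β)
    (hvb : v b = -β) :
    2 * descentTime lam κ β ≤ ∫ x in a..b, θ x ∧ (∫ x in a..b, θ x ≤ 2 * descentTime lam κ β →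
      ∃ s t, a ≤ s ∧ t ≤ b ∧ t - s = 2 * descentTime lam κ β ∧
        ∀ᵐ x, x ∈ Ioo a b → θ x = (Ioo s t).indicator 1 x) := by
  have hq := h.neg_le hl hκ
  have hcont := h.continuousOn hab
  have hup : ∀ x ∈ Icc a b, v x ≤ β := fun x hx =>
    h.riccati.le_of_le hq hlβ.le le_rfl hx.1 hx.2 hva.le
  have hlow : ∀ x ∈ Icc a b, -β ≤ v x := fun x hx => by
    by_contra! hlt
    have := h.riccati.lt_of_lt hq (by rw [neg_sq]; exact hlβ.le) hx.1 hx.2 le_rfl hlt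
    linarith
  obtain ⟨e, f⟩ := h.descent_le hab hl hκ (V := β) (K := 0) (by linarith)
    fun x hx => sq_le_sq' (hlow x hx) (hup x hx)
  rw [hva, hvb, descentTime_neg, zero_mul, zero_add, sub_zero, one_mul, sub_neg_eq_add,
    ← two_mul] at e f
  refine ⟨e, fun hle => ?_⟩
  have f := f hle
  -- an interval on which the state runs from `β` to `-β` without touching these levels inside
  obtain ⟨t0, ht0, hv0⟩ := intermediate_value_Icc' hab hcont
    (show (0 : ℝ) ∈ Icc (v b) (v a) by rw [hva, hvb]; exact ⟨by linarith, hβ.le⟩)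
  obtain ⟨s, hs, hvs, hslt⟩ := exists_last_time ht0.1 (hcont.mono (Icc_subset_Icc_right ht0.2))
    (V := β) hva.ge (by linarith)
  obtain ⟨t, ht, hvt, htlt⟩ := exists_first_time ht0.2 (hcont.mono (Icc_subset_Icc_left ht0.1))
    (V := -β) (by linarith) hvb.le
  have hst : s ≤ t := hs.2.trans ht.1
  have z2 : ∀ᵐ x, x ∈ Ioo s t → θ x = 1 := by
    filter_upwards [f] with x hx hxm
    have hxI : x ∈ Ioo a b := ⟨hs.1.trans_lt hxm.1, hxm.2.trans_le ht.2⟩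
    refine (hx hxI).resolve_right ?_
    have h1 : -β ≤ v x := hlow x (Ioo_subset_Icc_self hxI)
    have h2 : v x ≤ β := hup x (Ioo_subset_Icc_self hxI)
    refine (sq_lt_sq' (lt_of_le_of_ne h1 ?_) (lt_of_le_of_ne h2 ?_)).ne
    · intro h0
      rcases le_total x t0 with hx0 | hx0
      · -- the level `-β` is below the barrier, so it cannot be left before `t0`
        have := h.riccati.le_of_le hq (R := -β) (by rw [neg_sq]; exact hlβ.le) hxI.1.le hx0 ht0.2
          h0.ge
        linarith
      · exact absurd h0 (htlt x ⟨hx0, hxm.2⟩).ne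
    · intro h0
      rcases le_total x t0 with hx0 | hx0
      · exact absurd h0 (hslt x ⟨hxm.1, hx0⟩).ne
      · have := h.riccati.lt_of_lt hq (R := β) hlβ.le ht0.1 hx0 hxI.2.le (by linarith)
        linarith
  have hc1 := h.mono le_rfl hs.1 (hs.2.trans ht0.2)
  have hc2 := h.mono hs.1 hst ht.2
  have hc3 := h.mono (ht0.1.trans ht.1) ht.2 le_rfl
  have g2 := hc2.descent_eq hst hl hκ z2
  rw [hvs, hvt, descentTime_neg, sub_neg_eq_add, ← two_mul] at g2
  have hsum := h.integral_add hs.1 (hs.2.trans ht0.2)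
  have hsum2 := (h.mono hs.1 (hs.2.trans ht0.2) le_rfl).integral_add hst ht.2
  have i2 : ∫ x in s..t, θ x = t - s := by
    rw [intervalIntegral.integral_of_le hst, integral_Ioc_eq_integral_Ioo,
      setIntegral_congr_ae measurableSet_Ioo (g := fun _ => (1 : ℝ)) z2]
    simp [hst]
  have hpos : ∀ {p q : ℝ}, p ≤ q → IsControlled p q lam κ θ v →
      0 ≤ ∫ x in p..q, θ x ∧ (∫ x in p..q, θ x ≤ 0 → ∀ᵐ x, x ∈ Ioo p q → θ x = 0) := by
    intro p q hpq hc
    have hnn : 0 ≤ᵐ[volume.restrict (Ioo p q)] θ := by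
      rw [Filter.EventuallyLE, ae_restrict_iff' measurableSet_Ioo]
      exact hc.range.mono fun x hx hxm => (hx hxm).1
    rw [intervalIntegral.integral_of_le hpq, integral_Ioc_eq_integral_Ioo]
    refine ⟨setIntegral_nonneg_of_ae_restrict hnn, fun h0 => ?_⟩
    have := (setIntegral_eq_zero_iff_of_nonneg_ae hnn
      (hc.integrable.1.mono_set Ioo_subset_Ioc_self)).1
      (le_antisymm h0 (setIntegral_nonneg_of_ae_restrict hnn))
    rwa [Filter.EventuallyEq, ae_restrict_iff' measurableSet_Ioo] at this
  have p1 := hpos hs.1 hc1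
  have p3 := hpos ht.2 hc3
  exact ⟨s, t, hs.1, ht.2, g2.symm, ae_eq_indicator_of_pieces (p1.2 (by linarith [p3.1])) z2
    (p3.2 (by linarith [p1.1]))⟩

/-- For `β² < lam`, the case in which `|v|` is largest at a point where `v` is positive: the
cheapest control lets the state coast up from `β` to `w` and then descend to `-β`. -/
theorem IsControlled.le_integral_of_max (h : IsControlled a b lam κ θ v) (hl : 0 < lam)
    (hκ : 0 < κ) (hβ : 0 ≤ β) (hva : v a = β) (hvb : v b = -β) {w l : ℝ} (hβw : β < w)
    (hw : w < √lam) (hl1 : descentTime lam κ w + descentTime lam κ β = l)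
    (hl2 : coastTime lam w - coastTime lam β = b - a - l) {t : ℝ} (ht : t ∈ Icc a b)
    (hβt : β ≤ v t) (htl : v t < √lam) (hmax : ∀ x ∈ Icc a b, v x ^ 2 ≤ v t ^ 2) :
    l ≤ ∫ x in a..b, θ x ∧ (∫ x in a..b, θ x ≤ l →
      ∀ᵐ x, x ∈ Ioo a b → θ x = (Ioo (b - l) b).indicator 1 x) := by
  have hab := ht.1.trans ht.2
  have hlk := mul_pos hl hκ
  have hsq := Real.sq_sqrt hl.le
  obtain ⟨V, hVdef⟩ : ∃ V, v t = V := ⟨_, rfl⟩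
  rw [hVdef] at hβt htl hmax
  have hV0 : 0 ≤ V := hβ.trans hβt
  have hVl : V ^ 2 < lam := by
    rw [← hsq]; exact pow_lt_pow_left₀ htl hV0 two_ne_zero
  have hM : 0 < lam * (1 + κ) := by positivity
  obtain ⟨K, hK⟩ : ∃ K, K * (lam * (1 + κ)) = lam - V ^ 2 :=
    ⟨(lam - V ^ 2) / (lam * (1 + κ)), by field_simp⟩
  have hc1 := h.mono le_rfl ht.1 ht.2
  have hc2 := h.mono ht.1 ht.2 le_rfl
  have hcond : ∀ x ∈ Icc a b, v x ^ 2 ≠ lam ∧ (lam - V ^ 2) / (lam - v x ^ 2) ≤ 1 := by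
    intro x hx
    have := hmax x hx
    refine ⟨by linarith, ?_⟩
    rw [div_le_one (by linarith)]
    linarith
  obtain ⟨e1, f1⟩ := hc1.coast_le ht.1 hl hK
    fun x hx => hcond x ⟨hx.1, hx.2.trans ht.2⟩
  obtain ⟨e2, f2⟩ := hc2.descent_le ht.2 hl hκ hK fun x hx => hmax x ⟨ht.1.trans hx.1, hx.2⟩
  -- this cruder bound by the pure descent time suffices for maxima above `w`
  obtain ⟨e3, -⟩ := hc2.descent_le ht.2 hl hκ (V := √lam) (K := 0) (by rw [hsq]; ring)
    fun x hx => by rw [hsq]; exact (hmax x ⟨ht.1.trans hx.1, hx.2⟩).trans hVl.le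
  have e0 : 0 ≤ ∫ x in a..t, θ x := by
    rw [intervalIntegral.integral_of_le ht.1, integral_Ioc_eq_integral_Ioo]
    refine setIntegral_nonneg_of_ae_restrict ?_
    rw [Filter.EventuallyLE, ae_restrict_iff' measurableSet_Ioo]
    exact hc1.range.mono fun x hx hxm => (hx hxm).1
  rw [hva, hVdef] at e1 f1
  rw [hvb, hVdef, descentTime_neg] at e2 f2 e3
  have hsum := h.integral_add ht.1 ht.2
  have hmono := strictMono_descentTime hlk
  rcases lt_trichotomy V w with hlt | heq | hgt
  · -- a maximum below `w` is strictly too expensive: the cost bound exceeds `l` by the increase of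
    -- `K * coastTime - (1 - K) * descentTime` from `V` to `w`
    have hkey : (lam - V ^ 2) * coastTime lam V - (V ^ 2 + lam * κ) * descentTime lam κ V <
        (lam - V ^ 2) * coastTime lam w - (V ^ 2 + lam * κ) * descentTime lam κ w := by
      have hy : ∀ y ∈ Icc V w, y ^ 2 < lam := fun y hy => by
        rw [← hsq]; exact pow_lt_pow_left₀ (hy.2.trans_lt hw) (hV0.trans hy.1) two_ne_zero
      have hd : ∀ y ∈ Icc V w, HasDerivAt
          (fun y => (lam - V ^ 2) * coastTime lam y - (V ^ 2 + lam * κ) * descentTime lam κ y)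
          ((lam - V ^ 2) * (1 / (lam - y ^ 2)) -
            (V ^ 2 + lam * κ) * (1 / (y ^ 2 + lam * κ))) y := fun y hym =>
        ((coastTime_spec hl (hy y hym).ne).2.const_mul _).sub
          ((descentTime_spec hlk y).2.const_mul _)
      refine strictMonoOn_of_deriv_pos (convex_Icc V w)
        (fun y hym => (hd y hym).continuousAt.continuousWithinAt) (fun y hym => ?_)
        (left_mem_Icc.2 hlt.le) (right_mem_Icc.2 hlt.le) hlt
      rw [interior_Icc] at hym
      rw [(hd y (Ioo_subset_Icc_self hym)).deriv, mul_one_div, mul_one_div, sub_pos]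
      have h1 := hy y (Ioo_subset_Icc_self hym)
      have h2 : V ^ 2 < y ^ 2 := pow_lt_pow_left₀ hym.1 hV0 two_ne_zero
      have h3 : (V ^ 2 + lam * κ) / (y ^ 2 + lam * κ) < 1 := by
        rw [div_lt_one (by positivity)]; linarith
      have h4 : 1 < (lam - V ^ 2) / (lam - y ^ 2) := by
        rw [one_lt_div (by linarith)]; linarith
      linarith
    have hK' : (1 - K) * (lam * (1 + κ)) = V ^ 2 + lam * κ := by linear_combination -hK
    rw [← hK, ← hK'] at hkey
    have hkey2 : (1 - K) * (descentTime lam κ w - descentTime lam κ V) <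
        K * (coastTime lam w - coastTime lam V) := by
      refine lt_of_mul_lt_mul_right ?_ hM.le
      linarith
    have : l < ∫ x in a..b, θ x := by
      rw [← hsum]
      have hd : descentTime lam κ β = l - descentTime lam κ w := by linarith
      have hb : coastTime lam β = coastTime lam w - (b - a - l) := by linarith
      rw [hb] at e1
      rw [hd] at e2
      nlinarith
    exact ⟨this.le, fun h' => absurd h' this.not_ge⟩
  · obtain rfl : w = V := heq.symm
    have htot : K * (t - a) - K * (coastTime lam w - coastTime lam β) + (K * (b - t) +
        (1 - K) * (descentTime lam κ w - -descentTime lam κ β)) = l := by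
      rw [hl2, sub_neg_eq_add, hl1]; ring
    refine ⟨by linarith, fun hle => ?_⟩
    have f1 := f1 (by linarith)
    have f2 := f2 (by linarith)
    have hw0 : 0 < w := hβ.trans_lt hβw
    -- the first and the last time at which `|v| = w`
    have hcont := h.continuousOn hab
    obtain ⟨s1, hs1, hv1, hlt1⟩ := exists_first_time (v := fun x => -v x ^ 2) (V := -w ^ 2)
      ht.1 ((hcont.mono (Icc_subset_Icc_right ht.2)).pow 2).neg
      (by rw [hva]; nlinarith) (by rw [hVdef])
    obtain ⟨s2, hs2, hv2, hlt2⟩ := exists_last_time (v := fun x => v x ^ 2) (V := w ^ 2)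
      ht.2 ((hcont.mono (Icc_subset_Icc_left ht.1)).pow 2)
      (by rw [hVdef]) (by rw [hvb]; nlinarith)
    have z1 : ∀ᵐ x, x ∈ Ioo a s1 → θ x = 0 := by
      filter_upwards [f1] with x hx hxm
      refine (hx ⟨hxm.1, hxm.2.trans_le hs1.2⟩).resolve_right ?_
      have := hlt1 x ⟨hxm.1.le, hxm.2⟩
      linarith
    have z2 : ∀ᵐ x, x ∈ Ioo s2 b → θ x = 1 := by
      filter_upwards [f2] with x hx hxm
      refine (hx ⟨hs2.1.trans_lt hxm.1, hxm.2⟩).resolve_right ?_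
      exact (hlt2 x ⟨hxm.1, hxm.2.le⟩).ne
    have g1 := (h.mono le_rfl hs1.1 (hs1.2.trans ht.2)).coast_eq hs1.1 hl
      (fun x hx => (hcond x ⟨hx.1, hx.2.trans (hs1.2.trans ht.2)⟩).1) z1
    have g2 := (h.mono (ht.1.trans hs2.1) hs2.2 le_rfl).descent_eq hs2.2 hl hκ z2
    rw [hva] at g1
    rw [hvb, descentTime_neg] at g2
    have hB := strictMonoOn_coastTime hl
    have w1 : v s1 = w := by
      rcases sq_eq_sq_iff_eq_or_eq_neg.1 (neg_inj.1 hv1) with h' | h'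
      · exact h'
      · rw [h'] at g1
        have := hB (a := -w) (b := β) ⟨by linarith, by linarith⟩ ⟨by linarith, by linarith⟩
          (by linarith)
        linarith [hs1.1]
    have w2 : v s2 = w := by
      rcases sq_eq_sq_iff_eq_or_eq_neg.1 hv2 with h' | h'
      · exact h'
      · rw [h', descentTime_neg] at g2
        have := hmono hβw
        linarith [hs2.2]
    rw [w1, hl2] at g1
    rw [w2] at g2
    have k1 : b - l = s1 := by linarith
    have k2 : b - l = s2 := by linarith
    refine ae_eq_indicator_of_pieces (by rwa [k1]) (by rwa [k2]) ?_
    simp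
  · have : l < ∫ x in a..b, θ x := by
      have := hmono hgt
      linarith
    exact ⟨this.le, fun h' => absurd h' this.not_ge⟩

end

/-! ### Reflection -/

theorem ae_reflect {P : ℝ → Prop} (c : ℝ) (h : ∀ᵐ x, P x) : ∀ᵐ x, P (c - x) :=
  (Measure.measurePreserving_sub_left (volume : Measure ℝ) c).quasiMeasurePreserving.ae h

theorem mem_Ioo_reflect {a b x : ℝ} : a + b - x ∈ Ioo a b ↔ x ∈ Ioo a b :=
  ⟨fun h => ⟨by linarith [h.2], by linarith [h.1]⟩, fun h => ⟨by linarith [h.2], by linarith [h.1]⟩⟩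

theorem mem_Icc_reflect {a b x : ℝ} : a + b - x ∈ Icc a b ↔ x ∈ Icc a b :=
  ⟨fun h => ⟨by linarith [h.2], by linarith [h.1]⟩, fun h => ⟨by linarith [h.2], by linarith [h.1]⟩⟩

theorem ac_reflect {f : ℝ → ℝ} {a b : ℝ} (hab : a ≤ b)
    (hf : AbsolutelyContinuousOnInterval f a b) :
    AbsolutelyContinuousOnInterval (fun x => f (a + b - x)) a b := by
  rw [absolutelyContinuousOnInterval_iff] at hf ⊢
  intro ε hε
  obtain ⟨δ, hδ, h⟩ := hf ε hε
  refine ⟨δ, hδ, fun E hE hEδ => ?_⟩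
  refine h (E.1, fun i => (a + b - (E.2 i).2, a + b - (E.2 i).1)) ⟨fun i hi => ?_, ?_⟩ ?_ |>.trans_eq'
    ?_
  · have := hE.1 i hi
    rw [uIcc_of_le hab] at this ⊢
    exact ⟨mem_Icc_reflect.2 this.2, mem_Icc_reflect.2 this.1⟩
  · intro i hi j hj hij
    have h1 := hE.2 hi hj hij
    simp only [Function.onFun, uIoc, Ioc_disjoint_Ioc] at h1 ⊢
    grind
  · refine hEδ.trans_eq' (Finset.sum_congr rfl fun i _ => ?_)
    simp only [Real.dist_eq]
    rw [show a + b - (E.2 i).2 - (a + b - (E.2 i).1) = (E.2 i).1 - (E.2 i).2 by ring]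
  · exact Finset.sum_congr rfl fun i _ => dist_comm _ _

theorem hasDerivAt_reflect {f : ℝ → ℝ} {c y x : ℝ} (h : HasDerivAt f y (c - x)) :
    HasDerivAt (fun t => f (c - t)) (-y) x := by
  exact (h.scomp x ((hasDerivAt_id x).const_sub c)).congr_deriv (by simp)

theorem IsControlled.reflect {a b lam κ : ℝ} {θ v : ℝ → ℝ} (h : IsControlled a b lam κ θ v)
    (hab : a ≤ b) :
    IsControlled a b lam κ (fun x => θ (a + b - x)) (fun x => -v (a + b - x)) := by
  refine ⟨⟨(ac_reflect hab h.riccati.ac).neg, ?_⟩, ?_, ?_⟩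
  · filter_upwards [ae_reflect (a + b) h.riccati.deriv] with x hx hxm
    refine (hasDerivAt_reflect (hx (mem_Ioo_reflect.2 hxm))).neg.congr_deriv ?_
    ring
  · filter_upwards [ae_reflect (a + b) h.range] with x hx hxm
    exact hx (mem_Ioo_reflect.2 hxm)
  · have := h.integrable.comp_sub_left (a + b)
    simp only [add_sub_cancel_left, add_sub_cancel_right] at this
    exact this.symm

theorem IsPositiveEigenfunction.reflect {a b β lam : ℝ} {m u p : ℝ → ℝ} (hab : a ≤ b)
    (h : IsPositiveEigenfunction a b β m lam u p) :
    IsPositiveEigenfunction a b β (fun x => m (a + b - x)) lam (fun x => u (a + b - x))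
      (fun x => -p (a + b - x)) := by
  refine ⟨fun x hx => h.pos _ (mem_Ioo_reflect.2 hx), fun x hx => ?_,
    (ac_reflect hab h.absCont).neg, ?_, ?_, ?_⟩
  · have h1 := h.hasDeriv _ (mem_Icc_reflect.2 hx)
    have h2 := h1.scomp x ((hasDerivWithinAt_id x (Icc a b)).const_sub (a + b))
      fun y hy => mem_Icc_reflect.2 hy
    exact h2.congr_deriv (by simp)
  · have he := h.eqn
    rw [ae_restrict_iff' measurableSet_Ioo] at he ⊢
    filter_upwards [ae_reflect (a + b) he] with x hx hxm
    refine (hasDerivAt_reflect (hx (mem_Ioo_reflect.2 hxm))).neg.congr_deriv ?_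
    ring
  · simp [h.right]
  · simp [h.left]

/-- For `β² < lam` the cheapest control descends either first or last. -/
theorem IsControlled.le_integral_of_sq_lt {a b lam κ β : ℝ} {θ v : ℝ → ℝ}
    (h : IsControlled a b lam κ θ v) (hab : a ≤ b) (hl : 0 < lam)
    (hκ : 0 < κ) (hβ : 0 ≤ β) (hva : v a = β) (hvb : v b = -β) {w l : ℝ} (hβw : β < w)
    (hw : w < √lam) (hl1 : descentTime lam κ w + descentTime lam κ β = l)
    (hl2 : coastTime lam w - coastTime lam β = b - a - l) :
    l ≤ ∫ x in a..b, θ x ∧ (∫ x in a..b, θ x ≤ l →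
      (∀ᵐ x, x ∈ Ioo a b → θ x = (Ioo a (a + l)).indicator 1 x) ∨
      ∀ᵐ x, x ∈ Ioo a b → θ x = (Ioo (b - l) b).indicator 1 x) := by
  have hsq := Real.sq_sqrt hl.le
  have hq := h.neg_le hl hκ
  have hup : ∀ x ∈ Icc a b, v x < √lam := fun x hx =>
    h.riccati.lt_of_lt hq hsq.ge le_rfl hx.1 hx.2 (by linarith)
  have hlow : ∀ x ∈ Icc a b, -√lam < v x := fun x hx => by
    by_contra! hle
    have := h.riccati.le_of_le hq (by rw [neg_sq, hsq]) hx.1 hx.2 le_rfl hle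
    linarith
  obtain ⟨t, ht, hmax⟩ := isCompact_Icc.exists_isMaxOn (nonempty_Icc.2 hab)
    ((h.continuousOn hab).pow 2)
  have hmax : ∀ x ∈ Icc a b, v x ^ 2 ≤ v t ^ 2 := hmax
  have hβt : β ≤ |v t| := by
    have := hmax a (left_mem_Icc.2 hab)
    rw [hva] at this
    simpa [abs_of_nonneg hβ] using sq_le_sq.1 this
  rcases le_total 0 (v t) with h0 | h0
  · rw [abs_of_nonneg h0] at hβt
    obtain ⟨h1, h2⟩ := h.le_integral_of_max hl hκ hβ hva hvb hβw hw hl1 hl2 ht hβt (hup t ht) hmax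
    exact ⟨h1, fun h3 => Or.inr (h2 h3)⟩
  · rw [abs_of_nonpos h0] at hβt
    obtain ⟨h1, h2⟩ := (h.reflect hab).le_integral_of_max hl hκ hβ (by simp [hvb]) (by simp [hva])
      hβw hw hl1 hl2 (mem_Icc_reflect.2 ht) (by simpa using hβt)
      (by simpa using neg_lt.1 (hlow t ht)) fun x hx => by
        simpa using hmax _ (mem_Icc_reflect.2 hx)
    have hi : ∫ x in a..b, θ (a + b - x) = ∫ x in a..b, θ x := by
      rw [intervalIntegral.integral_comp_sub_left (f := θ)]
      simp
    rw [hi] at h1 h2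
    refine ⟨h1, fun h3 => Or.inl ?_⟩
    filter_upwards [ae_reflect (a + b) (h2 h3)] with x hx hxm
    have h4 := hx (mem_Ioo_reflect.2 hxm)
    simp only [sub_sub_cancel] at h4
    rw [h4]
    by_cases hm : x ∈ Ioo a (a + l)
    · rw [indicator_of_mem hm, indicator_of_mem
        (show a + b - x ∈ Ioo (b - l) b from ⟨by linarith [hm.2], by linarith [hm.1]⟩)]
      simp
    · rw [indicator_of_notMem hm, indicator_of_notMem
        fun hm' : a + b - x ∈ Ioo (b - l) b => hm ⟨by linarith [hm'.2], by linarith [hm'.1]⟩]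

/-! ### Trajectories generated by an interval -/

section

variable {a b lam κ β s t : ℝ} {θ v : ℝ → ℝ}

/-- While the control vanishes, the state cannot cross the equilibria `R = ±√lam` downwards. -/
theorem IsControlled.equilibrium_barrier (h : IsControlled a b lam κ θ v) (hab : a ≤ b)
    (hθ : ∀ᵐ x, x ∈ Ioo a b → θ x = 0) {R : ℝ} (hR : R ^ 2 = lam) :
    (R < v a → R < v b) ∧ (R ≤ v a → R ≤ v b) := by
  have hq : ∀ᵐ x, x ∈ Ioo a b → lam ≤ -(lam * ((1 + κ) * θ x - 1)) := by
    filter_upwards [hθ] with x hx hxm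
    rw [hx hxm]; linarith
  exact ⟨h.riccati.gt_of_gt hq hR.le le_rfl hab le_rfl, h.riccati.ge_of_ge hq hR.le le_rfl hab le_rfl⟩

/-- For `β ≤ √lam` the state stays in `[-√lam, √lam]`, so an interval of full control is at most as
long as the descent from `√lam` to `-√lam`. -/
theorem IsControlled.length_le (h : IsControlled a b lam κ θ v) (hl : 0 < lam) (hκ : 0 < κ)
    (has : a ≤ s) (hst : s ≤ t) (htb : t ≤ b) (hva : v a = β) (hvb : v b = -β)
    (hθ : ∀ᵐ x, x ∈ Ioo s t → θ x = 1) (hβl : β ≤ √lam) :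
    t - s ≤ 2 * descentTime lam κ (√lam) := by
  have hsq := Real.sq_sqrt hl.le
  have hq := h.neg_le hl hκ
  have h1 : v s ≤ √lam :=
    h.riccati.le_of_le hq hsq.ge le_rfl has (hst.trans htb) (by linarith)
  have h2 : -√lam ≤ v t := by
    by_contra! hlt
    have := h.riccati.lt_of_lt hq (by rw [neg_sq, hsq]) (has.trans hst) htb le_rfl hlt
    linarith
  have h3 := (h.mono has hst htb).descent_eq hst hl hκ hθ
  have hm := (strictMono_descentTime (mul_pos hl hκ)).monotone
  have h4 := hm h1
  have h5 := hm h2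
  rw [descentTime_neg] at h5
  linarith

/-- For `√lam ≤ β` coasting keeps the state outside `(-√lam, √lam)`, so the only interval of full
control has to be at least as long as the descent from `√lam` to `-√lam`. -/
theorem IsControlled.le_length (h : IsControlled a b lam κ θ v) (hl : 0 < lam) (hκ : 0 < κ)
    (has : a ≤ s) (hst : s ≤ t) (htb : t ≤ b) (hva : v a = β) (hvb : v b = -β)
    (hθ0 : ∀ᵐ x, x ∈ Ioo a s → θ x = 0) (hθ : ∀ᵐ x, x ∈ Ioo s t → θ x = 1)
    (hθ1 : ∀ᵐ x, x ∈ Ioo t b → θ x = 0) (hβl : √lam ≤ β) :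
    2 * descentTime lam κ (√lam) ≤ t - s := by
  have hsq := Real.sq_sqrt hl.le
  have h1 : √lam ≤ v s :=
    ((h.mono le_rfl has (hst.trans htb)).equilibrium_barrier has hθ0 hsq).2 (by linarith)
  have h2 : v t ≤ -√lam := by
    by_contra! hlt
    have := ((h.mono (has.trans hst) htb le_rfl).equilibrium_barrier htb hθ1
      (R := -√lam) (by rw [neg_sq, hsq])).1 hlt
    linarith
  have h3 := (h.mono has hst htb).descent_eq hst hl hκ hθ
  have hm := (strictMono_descentTime (mul_pos hl hκ)).monotone
  have h4 := hm h1
  have h5 := hm h2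
  rw [descentTime_neg] at h5
  linarith

/-- The turning level of the trajectory generated by a centred interval. -/
theorem IsControlled.exists_level_centered (h : IsControlled a b lam κ θ v) (hl : 0 < lam)
    (hκ : 0 < κ) (has : a ≤ s) (hst : s ≤ t) (htb : t ≤ b) (hva : v a = β) (hvb : v b = -β)
    (hθ0 : ∀ᵐ x, x ∈ Ioo a s → θ x = 0) (hθ : ∀ᵐ x, x ∈ Ioo s t → θ x = 1)
    (hθ1 : ∀ᵐ x, x ∈ Ioo t b → θ x = 0) (hβl : √lam < β) (hc : s - a = b - t) :
    ∃ V, √lam < V ∧ V ≤ β ∧ coastTime lam V - coastTime lam β = s - a ∧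
      2 * descentTime lam κ V = t - s := by
  have hs := Real.sqrt_nonneg lam
  have hsq := Real.sq_sqrt hl.le
  have hq := h.neg_le hl hκ
  have hA := h.mono le_rfl has (hst.trans htb)
  have hC := h.mono (has.trans hst) htb le_rfl
  have hne : ∀ y : ℝ, √lam < y → y ^ 2 ≠ lam := fun y hy => by
    nlinarith
  have h1 : ∀ x ∈ Icc a s, √lam < v x := fun x hx =>
    ((hA.mono le_rfl hx.1 hx.2).equilibrium_barrier hx.1
      (hθ0.mono fun y hy hym => hy ⟨hym.1, hym.2.trans_le hx.2⟩) hsq).1 (by linarith)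
  have h2 : ∀ x ∈ Icc t b, √lam < -v x := fun x hx => by
    by_contra! hle
    have := ((hC.mono hx.1 hx.2 le_rfl).equilibrium_barrier hx.2
      (hθ1.mono fun y hy hym => hy ⟨hx.1.trans_lt hym.1, hym.2⟩)
      (R := -√lam) (by rw [neg_sq, hsq])).2 (by linarith)
    linarith
  have e1 := hA.coast_eq has hl (fun x hx => hne _ (h1 x hx)) hθ0
  have e3 := hC.coast_eq htb hl (fun x hx => by
    have := hne _ (h2 x hx); rwa [neg_sq] at this) hθ1
  have e2 := (h.mono has hst htb).descent_eq hst hl hκ hθ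
  have hvs := h1 s (right_mem_Icc.2 has)
  have hvt := h2 t (left_mem_Icc.2 htb)
  -- both coasting phases last equally long, so they end at opposite levels
  have hsym : v s = -v t := by
    refine (strictAntiOn_coastTime hl).injOn hvs hvt ?_
    rw [coastTime_neg]
    rw [hvb, coastTime_neg] at e3
    rw [hva] at e1
    linarith
  refine ⟨v s, hvs, ?_, by rw [← hva]; exact e1, ?_⟩
  · exact h.riccati.le_of_le hq (by rw [← hsq]; exact pow_le_pow_left₀ hs hβl.le 2) le_rfl has
      (hst.trans htb) hva.le
  · rw [show v t = -v s by linarith, descentTime_neg] at e2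
    linarith

/-- The turning level of the trajectory generated by an interval at the left endpoint. -/
theorem IsControlled.exists_level_edge (h : IsControlled a b lam κ θ v) (hl : 0 < lam)
    (hκ : 0 < κ) (hat : a ≤ t) (htb : t < b) (hβ : 0 ≤ β) (hva : v a = β) (hvb : v b = -β)
    (hθ : ∀ᵐ x, x ∈ Ioo a t → θ x = 1) (hθ1 : ∀ᵐ x, x ∈ Ioo t b → θ x = 0) (hβl : β < √lam) :
    ∃ w, β < w ∧ w < √lam ∧ descentTime lam κ w + descentTime lam κ β = t - a ∧
      coastTime lam w - coastTime lam β = b - t := by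
  have hsq := Real.sq_sqrt hl.le
  have hq := h.neg_le hl hκ
  have hup : ∀ x ∈ Icc a b, v x < √lam := fun x hx =>
    h.riccati.lt_of_lt hq hsq.ge le_rfl hx.1 hx.2 (by linarith)
  have hlow : ∀ x ∈ Icc a b, -√lam < v x := fun x hx => by
    by_contra! hle
    have := h.riccati.le_of_le hq (by rw [neg_sq, hsq]) hx.1 hx.2 le_rfl hle
    linarith
  have e1 := (h.mono le_rfl hat htb.le).descent_eq hat hl hκ hθ
  have e2 := (h.mono hat htb.le le_rfl).coast_eq htb.le hl (fun x hx => by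
    have hx' : x ∈ Icc a b := ⟨hat.trans hx.1, hx.2⟩
    have := sq_lt_sq' (hlow x hx') (hup x hx')
    rw [hsq] at this
    exact this.ne) hθ1
  have ht : t ∈ Icc a b := ⟨hat, htb.le⟩
  have hwt : -v t < √lam := by linarith [hlow t ht]
  rw [hvb, coastTime_neg] at e2
  rw [hva] at e1
  refine ⟨-v t, ?_, hwt, by rw [descentTime_neg]; linarith, by rw [coastTime_neg]; linarith⟩
  by_contra! hle
  have := (strictMonoOn_coastTime hl).monotoneOn (a := -v t) (b := β)
    ⟨by linarith [hup t ht], hwt⟩ ⟨by linarith, hβl⟩ hle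
  rw [coastTime_neg] at this
  linarith

end

/-! ### The linear equation -/

/-- `u` is a solution of `u'' + q u = 0` on `[a, b]`, with derivative `p` absolutely continuous. -/
structure IsLinearSol (a b : ℝ) (q u p : ℝ → ℝ) : Prop where
  hasDeriv : ∀ x ∈ Icc a b, HasDerivWithinAt u (p x) (Icc a b) x
  absCont : AbsolutelyContinuousOnInterval p a b
  eqn : ∀ᵐ x, x ∈ Ioo a b → HasDerivAt p (-(q x * u x)) x

section

variable {a b β lam Q : ℝ} {q m u p : ℝ → ℝ}

theorem IsPositiveEigenfunction.isLinearSol (h : IsPositiveEigenfunction a b β m lam u p) :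
    IsLinearSol a b (fun x => lam * m x) u p :=
  ⟨h.hasDeriv, h.absCont, (ae_restrict_iff' measurableSet_Ioo).1 h.eqn⟩

theorem IsLinearSol.isPositiveEigenfunction (h : IsLinearSol a b (fun x => lam * m x) u p)
    (hpos : ∀ x ∈ Icc a b, 0 < u x) (hl : p a = β * u a) (hr : p b = -β * u b) :
    IsPositiveEigenfunction a b β m lam u p :=
  ⟨fun x hx => hpos x (Ioo_subset_Icc_self hx), h.hasDeriv, h.absCont,
    (ae_restrict_iff' measurableSet_Ioo).2 h.eqn, hl, hr⟩

theorem IsLinearSol.ac (h : IsLinearSol a b q u p) (hab : a ≤ b) :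
    AbsolutelyContinuousOnInterval u a b :=
  ac_of_hasDerivWithinAt hab h.hasDeriv (ac_continuousOn hab h.absCont)

theorem IsLinearSol.hasDerivAt (h : IsLinearSol a b q u p) {x : ℝ} (hx : x ∈ Ioo a b) :
    HasDerivAt u (p x) x :=
  (h.hasDeriv x (Ioo_subset_Icc_self hx)).hasDerivAt (Icc_mem_nhds hx.1 hx.2)

/-- A solution with a double zero vanishes identically: the energy `u² + p²` grows and decays at
most exponentially. -/
theorem IsLinearSol.eq_zero_of_double_zero (h : IsLinearSol a b q u p)
    (hQ : ∀ᵐ x, x ∈ Ioo a b → |q x| ≤ Q) {s : ℝ} (hs : s ∈ Icc a b) (hu : u s = 0)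
    (hp : p s = 0) : ∀ x ∈ Icc a b, u x = 0 := by
  have hab := hs.1.trans hs.2
  have hac : AbsolutelyContinuousOnInterval (fun x => u x * u x + p x * p x) a b :=
    ((h.ac hab).mul (h.ac hab)).add (h.absCont.mul h.absCont)
  have hd : ∀ᵐ x, x ∈ Ioo a b → HasDerivAt (fun x => u x * u x + p x * p x)
      (2 * (u x * p x) * (1 - q x)) x := by
    filter_upwards [h.eqn] with x hx hxm
    have h1 := h.hasDerivAt hxm
    refine ((h1.mul h1).add ((hx hxm).mul (hx hxm))).congr_deriv ?_
    ring
  have hb : ∀ᵐ x, x ∈ Ioo a b →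
      |2 * (u x * p x) * (1 - q x)| ≤ (1 + Q) * (u x * u x + p x * p x) := by
    filter_upwards [hQ] with x hx hxm
    rw [abs_mul]
    have h1 : |2 * (u x * p x)| ≤ u x * u x + p x * p x := by
      rw [abs_le]
      constructor <;> nlinarith [sq_nonneg (u x + p x), sq_nonneg (u x - p x)]
    have h2 : |1 - q x| ≤ 1 + Q := by
      have := hx hxm
      rw [abs_le] at this ⊢
      constructor <;> linarith
    calc _ ≤ (u x * u x + p x * p x) * (1 + Q) :=
          mul_le_mul h1 h2 (abs_nonneg _) (by nlinarith)
      _ = _ := mul_comm _ _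
  intro x hx
  have hnn : 0 ≤ u x * u x + p x * p x := by nlinarith
  have hW : u x * u x + p x * p x = 0 := by
    rcases le_total s x with hsx | hxs
    · refine le_antisymm ?_ hnn
      refine nonpos_of_deriv_le (c := fun _ => -(1 + Q)) hac hd continuousOn_const ?_ hs.1 hsx hx.2
        (by simp [hu, hp])
      filter_upwards [hb] with y hy hym
      linarith [(abs_le.1 (hy hym)).2]
    · by_contra hne
      have := neg_of_deriv_le (c := fun _ => 1 + Q) hac.neg
        (hd.mono fun y hy hym => (hy hym).neg) continuousOn_const (by
          filter_upwards [hb] with y hy hym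
          simp only [Pi.neg_apply]
          linarith [(abs_le.1 (hy hym)).1]) hx.1 hxs hs.2
        (neg_neg_of_pos (lt_of_le_of_ne hnn (Ne.symm hne)))
      simp [hu, hp] at this
  nlinarith

/-- By the Robin conditions, a zero at an endpoint would be a double zero. -/
theorem IsPositiveEigenfunction.pos_Icc (h : IsPositiveEigenfunction a b β m lam u p)
    (hab : a < b) (hm : ∀ x, |m x| ≤ Q) : ∀ x ∈ Icc a b, 0 < u x := by
  have hL := h.isLinearSol
  have hQ : ∀ᵐ x, x ∈ Ioo a b → |lam * m x| ≤ |lam| * Q := .of_forall fun x _ => by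
    rw [abs_mul]; exact mul_le_mul_of_nonneg_left (hm x) (abs_nonneg _)
  obtain ⟨c, hc⟩ := nonempty_Ioo.2 hab
  have hcont := ac_continuousOn hab.le (hL.ac hab.le)
  have hne : ∀ x ∈ Icc a b, p x = 0 → u x ≠ 0 := fun x hx hp hu =>
    (h.pos c hc).ne' (hL.eq_zero_of_double_zero hQ hx hu hp c (Ioo_subset_Icc_self hc))
  have hge : ∀ x ∈ Icc a b, 0 ≤ u x := by
    intro x hx
    have hcl : x ∈ closure (Ioo a b) := by rwa [closure_Ioo hab.ne]
    have hsub : Ioo a b ⊆ Icc a b ∩ u ⁻¹' Ici 0 := fun y hy =>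
      ⟨Ioo_subset_Icc_self hy, (h.pos y hy).le⟩
    exact (closure_minimal hsub
      (hcont.preimage_isClosed_of_isClosed isClosed_Icc isClosed_Ici) hcl).2
  intro x hx
  refine lt_of_le_of_ne (hge x hx) fun h0 => ?_
  by_cases hxm : x ∈ Ioo a b
  · exact (h.pos x hxm).ne h0
  · have : x = a ∨ x = b := by
      by_contra! hc'
      exact hxm ⟨lt_of_le_of_ne hx.1 hc'.1.symm, lt_of_le_of_ne hx.2 hc'.2⟩
    rcases this with rfl | rfl
    · exact hne x hx (by rw [h.left, ← h0, mul_zero]) h0.symm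
    · exact hne x hx (by rw [h.right, ← h0, mul_zero]) h0.symm

theorem IsLinearSol.isRiccati (h : IsLinearSol a b q u p) (hab : a ≤ b)
    (hpos : ∀ x ∈ Icc a b, 0 < u x) : IsRiccati a b q (fun x => p x / u x) :=
  isRiccati_div hab hpos h.hasDeriv h.absCont h.eqn

theorem IsPositiveEigenfunction.exists_isRiccati (h : IsPositiveEigenfunction a b β m lam u p)
    (hab : a < b) (hm : ∀ x, |m x| ≤ Q) :
    ∃ v, IsRiccati a b (fun x => lam * m x) v ∧ v a = β ∧ v b = -β := by
  have hpos := h.pos_Icc hab hm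
  refine ⟨_, h.isLinearSol.isRiccati hab.le hpos, ?_, ?_⟩
  · have := (hpos a (left_mem_Icc.2 hab.le)).ne'
    simp only [h.left]; field_simp
  · have := (hpos b (right_mem_Icc.2 hab.le)).ne'
    simp only [h.right]; field_simp

end

/-! ### Comparison of spectral parameters -/

/-- If a positive supersolution exists at a parameter above a principal eigenvalue, then the
weight vanishes: by concavity of `v ↦ -v²`, the multiple `(lam₁ / lam₂) v₂` is a strict
supersolution at the parameter `lam₁`. -/
theorem ae_eq_zero_of_supersolution {a b β lam₁ lam₂ : ℝ} {m v₁ v₂ : ℝ → ℝ} (hab : a < b)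
    (hβ : 0 ≤ β) (h₁ : IsRiccati a b (fun x => lam₁ * m x) v₁)
    (h₂ : IsRiccati a b (fun x => lam₂ * m x) v₂) (hl : 0 < lam₁) (hlt : lam₁ < lam₂)
    (ha₁ : v₁ a = β) (hb₁ : v₁ b = -β) (ha₂ : v₂ a = β) (hb₂ : -β ≤ v₂ b) :
    ∀ᵐ x, x ∈ Ioo a b → m x = 0 := by
  have hl2 := hl.trans hlt
  obtain ⟨s, hs⟩ : ∃ s, s = lam₁ / lam₂ := ⟨_, rfl⟩
  have hs0 : 0 < s := by rw [hs]; positivity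
  have hs1 : s < 1 := by rw [hs, div_lt_one hl2]; exact hlt
  have hsl : s * lam₂ = lam₁ := by rw [hs]; field_simp
  have hd : ∀ᵐ x, x ∈ Ioo a b → HasDerivAt (fun x => s * v₂ x - v₁ x)
      (v₁ x ^ 2 - s * v₂ x ^ 2) x := by
    filter_upwards [h₁.deriv, h₂.deriv] with x h1 h2 hxm
    refine (((h2 hxm).const_mul s).sub (h1 hxm)).congr_deriv ?_
    linear_combination -m x * hsl
  have hc1 := ac_continuousOn hab.le h₁.ac
  have hc2 := ac_continuousOn hab.le h₂.ac
  have hanti := antitoneOn_mul_exp hab.le ((h₂.ac.const_mul s).sub h₁.ac) hd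
    (c := fun x => s * v₂ x + v₁ x) ((continuousOn_const.mul hc2).add hc1) (by
      refine .of_forall fun x _ => ?_
      simp only [Pi.sub_apply]
      nlinarith [mul_nonneg (mul_nonneg hs0.le (sub_nonneg.2 hs1.le)) (sq_nonneg (v₂ x))])
  have hzero : ∀ x ∈ Icc a b, s * v₂ x = v₁ x := by
    intro x hx
    have e1 := hanti (left_mem_Icc.2 hab.le) hx hx.1
    have e2 := hanti hx (right_mem_Icc.2 hab.le) hx.2
    simp only [Pi.sub_apply, ha₁, ha₂, hb₁] at e1 e2
    have k1 : (s * β - β) * Real.exp (∫ t in a..a, (s * v₂ t + v₁ t)) ≤ 0 :=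
      mul_nonpos_of_nonpos_of_nonneg (by nlinarith) (Real.exp_pos _).le
    have k2 : 0 ≤ (s * v₂ b - -β) * Real.exp (∫ t in a..b, (s * v₂ t + v₁ t)) :=
      mul_nonneg (by nlinarith) (Real.exp_pos _).le
    have k3 := le_antisymm (e1.trans k1) (k2.trans e2)
    rcases mul_eq_zero.1 k3 with h | h
    · linarith
    · exact absurd h (Real.exp_pos _).ne'
  have hv2 : ∀ x ∈ Ioo a b, v₂ x = 0 := by
    have hae : v₂ =ᵐ[volume.restrict (Ioo a b)] fun _ => 0 := by
      rw [Filter.EventuallyEq, ae_restrict_iff' measurableSet_Ioo]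
      filter_upwards [hd] with x hx hxm
      have h0 := hasDerivAt_zero_of_const hxm (c := 0)
        (fun t ht => sub_eq_zero.2 (hzero t (Ioo_subset_Icc_self ht))) (hx hxm)
      rw [← hzero x (Ioo_subset_Icc_self hxm)] at h0
      have h1 : s * (1 - s) * v₂ x ^ 2 = 0 := by linarith
      have h2 : s * (1 - s) ≠ 0 := (mul_pos hs0 (sub_pos.2 hs1)).ne'
      exact pow_eq_zero_iff two_ne_zero |>.1 ((mul_eq_zero.1 h1).resolve_left h2)
    exact Measure.eqOn_open_of_ae_eq hae isOpen_Ioo (hc2.mono Ioo_subset_Icc_self)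
      continuousOn_const
  filter_upwards [h₂.deriv] with x hx hxm
  have h0 := hasDerivAt_zero_of_const hxm hv2 (hx hxm)
  rw [hv2 x hxm] at h0
  have : lam₂ * m x = 0 := by linarith
  exact (mul_eq_zero.1 this).resolve_left hl2.ne'

/-! ### The Volterra operator -/

section Volterra

variable {a b : ℝ}

/-- The extension of a continuous function on `[a, b]` by its endpoint values. -/
noncomputable def extend (hab : a ≤ b) (f : C(Icc a b, ℝ)) : ℝ → ℝ := IccExtend hab f

theorem extend_apply (hab : a ≤ b) (f : C(Icc a b, ℝ)) {x : ℝ} (hx : x ∈ Icc a b) :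
    extend hab f x = f ⟨x, hx⟩ := IccExtend_of_mem hab f hx

theorem continuous_extend (hab : a ≤ b) (f : C(Icc a b, ℝ)) : Continuous (extend hab f) :=
  f.continuous.Icc_extend'

theorem abs_extend_le (hab : a ≤ b) (f : C(Icc a b, ℝ)) (x : ℝ) : |extend hab f x| ≤ ‖f‖ :=
  f.norm_coe_le_norm _

theorem intervalIntegrable_mul {q f : ℝ → ℝ} {Q : ℝ} (hq : Measurable q) (hQ : ∀ x, |q x| ≤ Q)
    (hf : Continuous f) (x y : ℝ) : IntervalIntegrable (fun t => q t * f t) volume x y := by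
  have h := hf.intervalIntegrable (μ := volume) x y
  exact ⟨h.1.bdd_mul hq.aestronglyMeasurable (.of_forall hQ),
    h.2.bdd_mul hq.aestronglyMeasurable (.of_forall hQ)⟩

/-- The Volterra operator `f ↦ ∫ₐˣ q f` on the continuous functions on `[a, b]`, for a bounded
measurable kernel `q`. -/
noncomputable def volterra (hab : a ≤ b) {q : ℝ → ℝ} {Q : ℝ} (hq : Measurable q)
    (hQ : ∀ x, |q x| ≤ Q) : C(Icc a b, ℝ) →L[ℝ] C(Icc a b, ℝ) :=
  LinearMap.mkContinuous
    { toFun := fun f => ⟨fun x => ∫ t in a..x, q t * extend hab f t,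
        (intervalIntegral.continuous_primitive (fun x y =>
          intervalIntegrable_mul hq hQ (continuous_extend hab f) x y) a).comp
          continuous_subtype_val⟩
      map_add' := fun f g => by
        ext x
        simp only [ContinuousMap.coe_mk, ContinuousMap.add_apply]
        rw [← intervalIntegral.integral_add
          (intervalIntegrable_mul hq hQ (continuous_extend hab f) _ _)
          (intervalIntegrable_mul hq hQ (continuous_extend hab g) _ _)]
        refine intervalIntegral.integral_congr fun t _ => ?_
        simp only [extend, IccExtend, Function.comp, ContinuousMap.add_apply]
        ring
      map_smul' := fun c f => by
        ext x
        simp only [ContinuousMap.coe_mk, ContinuousMap.smul_apply, RingHom.id_apply, smul_eq_mul]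
        rw [← intervalIntegral.integral_const_mul]
        refine intervalIntegral.integral_congr fun t _ => ?_
        simp only [extend, IccExtend, Function.comp, ContinuousMap.smul_apply, smul_eq_mul]
        ring }
    (Q * (b - a)) fun f => by
      have hQ0 : 0 ≤ Q := (abs_nonneg _).trans (hQ 0)
      have hba := sub_nonneg.2 hab
      refine (ContinuousMap.norm_le _ (by positivity)).2 fun x => ?_
      refine (intervalIntegral.norm_integral_le_of_norm_le_const (C := Q * ‖f‖) fun t _ => ?_).trans
        ?_
      · rw [norm_mul]
        exact mul_le_mul (hQ t) (abs_extend_le hab f t) (norm_nonneg _) hQ0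
      · rw [abs_of_nonneg (sub_nonneg.2 x.2.1)]
        have : (x : ℝ) - a ≤ b - a := by linarith [x.2.2]
        calc Q * ‖f‖ * (x - a) ≤ Q * ‖f‖ * (b - a) := by gcongr
          _ = _ := by ring

theorem volterra_apply (hab : a ≤ b) {q : ℝ → ℝ} {Q : ℝ} (hq : Measurable q)
    (hQ : ∀ x, |q x| ≤ Q) (f : C(Icc a b, ℝ)) (x : Icc a b) :
    volterra hab hq hQ f x = ∫ t in a..x, q t * extend hab f t := rfl

/-- The induction step for the factorial decay of iterated Volterra operators. -/
theorem abs_volterra_le (hab : a ≤ b) {q : ℝ → ℝ} {Q : ℝ} (hq : Measurable q)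
    (hQ : ∀ x, |q x| ≤ Q) (f : C(Icc a b, ℝ)) {C : ℝ} (n : ℕ)
    (hf : ∀ x, |f x| ≤ C * ((x - a) ^ n / n.factorial)) (x : Icc a b) :
    |volterra hab hq hQ f x| ≤ Q * C * ((x - a) ^ (n + 1) / (n + 1).factorial) := by
  have hQ0 : 0 ≤ Q := (abs_nonneg _).trans (hQ 0)
  rw [volterra_apply]
  have h1 : ‖∫ t in a..x, q t * extend hab f t‖ ≤
      ∫ t in a..x, Q * C / n.factorial * (t - a) ^ n := by
    refine intervalIntegral.norm_integral_le_of_norm_le x.2.1 ?_ ?_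
    · refine .of_forall fun t ht => ?_
      have htm : t ∈ Icc a b := ⟨ht.1.le, ht.2.trans x.2.2⟩
      rw [norm_mul, extend_apply hab f htm]
      calc ‖q t‖ * ‖f ⟨t, htm⟩‖ ≤ Q * (C * ((t - a) ^ n / n.factorial)) :=
            mul_le_mul (hQ t) (hf ⟨t, htm⟩) (norm_nonneg _) hQ0
        _ = _ := by ring
    · exact (by fun_prop : Continuous _).intervalIntegrable _ _
  refine h1.trans_eq ?_
  rw [intervalIntegral.integral_const_mul,
    intervalIntegral.integral_comp_sub_right (fun t => t ^ n), integral_pow]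
  rw [sub_self, zero_pow n.succ_ne_zero, Nat.factorial_succ]
  push_cast
  field_simp
  ring

theorem isUnit_one_add_of_norm_pow_lt_one {A : Type*} [NormedRing A] [CompleteSpace A] {T : A}
    {n : ℕ} (h : ‖T ^ n‖ < 1) : IsUnit (1 + T) := by
  have hnorm : ‖(-T) ^ n‖ < 1 := by
    rcases n.even_or_odd with hn | hn
    · rwa [hn.neg_pow]
    · rwa [hn.neg_pow, norm_neg]
  have hu := isUnit_one_sub_of_norm_lt_one hnorm
  have hcomm : Commute (1 - -T) (∑ i ∈ Finset.range n, (-T) ^ i) := by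
    refine Commute.sum_right _ _ _ fun i _ => ?_
    exact ((Commute.one_left _).sub_left (Commute.refl _)).pow_right i
  rw [← mul_neg_geom_sum, hcomm.isUnit_mul_iff, sub_neg_eq_add] at hu
  exact hu.1

theorem continuous_ring_inverse {A X : Type*} [NormedRing A] [CompleteSpace A]
    [TopologicalSpace X] {g : X → A} (hg : Continuous g) (hu : ∀ x, IsUnit (g x)) :
    Continuous fun x => Ring.inverse (g x) := by
  rw [continuous_iff_continuousAt]
  intro x
  obtain ⟨w, hw⟩ := hu x
  have h := NormedRing.inverse_continuousAt w
  rw [hw] at h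
  exact ContinuousAt.comp (f := g) h hg.continuousAt

/-- Powers of a product of two Volterra operators decay factorially in norm, so the product plus the
identity is invertible, whatever the size of the kernels. -/
theorem isUnit_one_add_volterra_mul (hab : a ≤ b) {q r : ℝ → ℝ} {Q R : ℝ} (hq : Measurable q)
    (hQ : ∀ x, |q x| ≤ Q) (hr : Measurable r) (hR : ∀ x, |r x| ≤ R) :
    IsUnit (1 + volterra hab hr hR * volterra hab hq hQ) := by
  have hQ0 : 0 ≤ Q := (abs_nonneg _).trans (hQ 0)
  have hR0 : 0 ≤ R := (abs_nonneg _).trans (hR 0)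
  have hba := sub_nonneg.2 hab
  set T := volterra hab hr hR * volterra hab hq hQ with hT
  have hpow : ∀ (n : ℕ) (f : C(Icc a b, ℝ)) (x : Icc a b),
      |(T ^ n) f x| ≤ (R * Q) ^ n * ‖f‖ * ((x - a) ^ (2 * n) / (2 * n).factorial) := by
    intro n
    induction n with
    | zero => intro f x; simpa using f.norm_coe_le_norm x
    | succ k ih =>
      intro f x
      rw [pow_succ', mul_apply_eq_comp]
      have h1 := abs_volterra_le hab hq hQ ((T ^ k) f) (2 * k) (ih f)
      have h2 := abs_volterra_le hab hr hR _ (2 * k + 1) h1 x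
      refine h2.trans_eq ?_
      rw [show 2 * (k + 1) = 2 * k + 1 + 1 by ring]
      ring
  obtain ⟨n, hn⟩ : ∃ n : ℕ, ((R * Q * (b - a) ^ 2) ^ n) / (2 * n).factorial < 1 := by
    have h1 := FloorSemiring.tendsto_pow_div_factorial_atTop (R * Q * (b - a) ^ 2)
    obtain ⟨n, hn⟩ := (h1.eventually (gt_mem_nhds one_pos)).exists
    refine ⟨n, lt_of_le_of_lt ?_ hn⟩
    gcongr
    omega
  refine isUnit_one_add_of_norm_pow_lt_one (A := C(Icc a b, ℝ) →L[ℝ] C(Icc a b, ℝ)) (n := n) ?_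
  refine lt_of_le_of_lt (ContinuousLinearMap.opNorm_le_bound _ (by positivity) fun f => ?_) hn
  refine (ContinuousMap.norm_le _ (by positivity)).2 fun x => ?_
  refine (hpow n f x).trans ?_
  have h2 : (x : ℝ) - a ≤ b - a := by linarith [x.2.2]
  have h3 : 0 ≤ (x : ℝ) - a := sub_nonneg.2 x.2.1
  calc (R * Q) ^ n * ‖f‖ * ((x - a) ^ (2 * n) / (2 * n).factorial)
      ≤ (R * Q) ^ n * ‖f‖ * ((b - a) ^ (2 * n) / (2 * n).factorial) := by gcongr
    _ = _ := by rw [mul_pow _ ((b - a) ^ 2), ← pow_mul]; ring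

end Volterra

/-! ### Shooting -/

section Shooting

variable {a b : ℝ}

theorem ac_congr {f g : ℝ → ℝ} (hab : a ≤ b) (hf : AbsolutelyContinuousOnInterval f a b)
    (h : ∀ x ∈ Icc a b, f x = g x) : AbsolutelyContinuousOnInterval g a b := by
  rw [absolutelyContinuousOnInterval_iff] at hf ⊢
  intro ε hε
  obtain ⟨δ, hδ, hE⟩ := hf ε hε
  refine ⟨δ, hδ, fun E hm hEδ => (hE E hm hEδ).trans_eq' (Finset.sum_congr rfl fun i hi => ?_)⟩
  have h1 := hm.1 i hi
  rw [uIcc_of_le hab] at h1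
  rw [h _ h1.1, h _ h1.2]

/-- Solutions of the initial value problem `u'' + (q₀ + τ q₁) u = 0`, `u(a) = 1`, `u'(a) = β`
exist and depend continuously on `τ`. -/
theorem exists_linear_family (hab : a < b) (β : ℝ) {q₀ q₁ : ℝ → ℝ} {Q₀ Q₁ : ℝ}
    (hq₀ : Measurable q₀) (hQ₀ : ∀ x, |q₀ x| ≤ Q₀) (hq₁ : Measurable q₁)
    (hQ₁ : ∀ x, |q₁ x| ≤ Q₁) :
    ∃ u p : ℝ → ℝ → ℝ,
      (∀ τ, IsLinearSol a b (fun x => q₀ x + τ * q₁ x) (u τ) (p τ) ∧ u τ a = 1 ∧ p τ a = β) ∧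
      (∀ x ∈ Icc a b, Continuous fun τ => u τ x) ∧ (Continuous fun τ => p τ b) ∧
      (Continuous fun τ => ∫ x in a..b, q₁ x * u τ x) ∧
      IsOpen {τ | ∀ x ∈ Icc a b, 0 < u τ x} := by
  have hI := hab.le
  have hb : b ∈ Icc a b := right_mem_Icc.2 hI
  have ha : a ∈ Icc a b := left_mem_Icc.2 hI
  have hqm : ∀ τ : ℝ, Measurable fun x => q₀ x + τ * q₁ x := fun τ =>
    hq₀.add (hq₁.const_mul τ)
  have hqb : ∀ τ x : ℝ, |q₀ x + τ * q₁ x| ≤ Q₀ + |τ| * Q₁ := fun τ x => by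
    refine (abs_add_le _ _).trans (add_le_add (hQ₀ x) ?_)
    rw [abs_mul]
    exact mul_le_mul_of_nonneg_left (hQ₁ x) (abs_nonneg _)
  have h1b : ∀ _x : ℝ, |(1 : ℝ)| ≤ 1 := fun _ => by simp
  set J := volterra hI (measurable_const (a := (1 : ℝ))) h1b with hJ
  have hsplit : ∀ τ, volterra hI (hqm τ) (hqb τ) =
      volterra hI hq₀ hQ₀ + τ • volterra hI hq₁ hQ₁ := by
    intro τ
    ext f x
    simp only [volterra_apply, add_apply, smul_apply,
      ContinuousMap.add_apply, ContinuousMap.smul_apply, smul_eq_mul]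
    have i0 := intervalIntegrable_mul hq₀ hQ₀ (continuous_extend hI f) a x
    have i1 := intervalIntegrable_mul hq₁ hQ₁ (continuous_extend hI f) a x
    rw [← intervalIntegral.integral_const_mul, ← intervalIntegral.integral_add i0 (i1.const_mul τ)]
    refine intervalIntegral.integral_congr fun t _ => ?_
    ring
  set D : ℝ → (C(Icc a b, ℝ) →L[ℝ] C(Icc a b, ℝ)) := fun τ =>
    volterra hI (hqm τ) (hqb τ) with hD
  have hDc : Continuous D := by
    simp only [hD, hsplit]
    fun_prop
  have hunit : ∀ τ, IsUnit (1 + J * D τ) := fun τ =>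
    isUnit_one_add_volterra_mul hI (hqm τ) (hqb τ) measurable_const h1b
  set c : C(Icc a b, ℝ) := ContinuousMap.const _ β with hc
  set U : ℝ → C(Icc a b, ℝ) := fun τ =>
    Ring.inverse (1 + J * D τ) (ContinuousMap.const _ 1 + J c) with hU
  have hUc : Continuous U := by
    have h1 : Continuous fun τ => Ring.inverse (1 + J * D τ) :=
      continuous_ring_inverse (A := C(Icc a b, ℝ) →L[ℝ] C(Icc a b, ℝ))
        (continuous_const.add (continuous_const.clm_comp hDc)) hunit
    exact h1.clm_apply continuous_const
  set P : ℝ → C(Icc a b, ℝ) := fun τ => c - D τ (U τ) with hP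
  have hPc : Continuous P := continuous_const.sub (hDc.clm_apply hUc)
  -- the integral form of the equation
  have hUeq : ∀ τ, U τ = ContinuousMap.const _ 1 + J (P τ) := by
    intro τ
    have h1 : (1 + J * D τ) (U τ) = ContinuousMap.const _ 1 + J c := by
      simp only [hU]
      rw [← mul_apply_eq_comp, Ring.mul_inverse_cancel _ (hunit τ),
        one_apply_eq_self]
    have h2 : U τ + J (D τ (U τ)) = ContinuousMap.const _ 1 + J c := h1
    simp only [hP, map_sub]
    rw [← add_sub_assoc, ← h2, add_sub_cancel_right]
  have hUx : ∀ τ, ∀ x ∈ Icc a b, extend hI (U τ) x = 1 + ∫ t in a..x, extend hI (P τ) t := by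
    intro τ x hx
    rw [extend_apply hI _ hx, hUeq τ, ContinuousMap.add_apply, hJ, volterra_apply]
    simp
  have hPx : ∀ τ, ∀ x ∈ Icc a b, extend hI (P τ) x =
      β - ∫ t in a..x, (q₀ t + τ * q₁ t) * extend hI (U τ) t := by
    intro τ x hx
    rw [extend_apply hI _ hx]
    rfl
  refine ⟨fun τ => extend hI (U τ), fun τ => extend hI (P τ), fun τ => ⟨⟨fun x hx => ?_, ?_, ?_⟩,
    ?_, ?_⟩, fun x hx => ?_, ?_, ?_, ?_⟩
  · have h1 := (((continuous_extend hI (P τ)).integral_hasStrictDerivAt a x).hasDerivAt.const_add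
      1).hasDerivWithinAt (s := Icc a b)
    exact h1.congr (fun y hy => hUx τ y hy) (hUx τ x hx)
  · have hi := intervalIntegrable_mul (hqm τ) (hqb τ) (continuous_extend hI (U τ)) a b
    have h1 := (ac_const β a b).sub
      (hi.absolutelyContinuousOnInterval_intervalIntegral left_mem_uIcc)
    exact ac_congr hI h1 fun x hx => (hPx τ x hx).symm
  · have hi := intervalIntegrable_mul (hqm τ) (hqb τ) (continuous_extend hI (U τ)) a b
    filter_upwards [hi.ae_hasDerivAt_integral] with x hx hxm
    have hxI := Ioo_subset_Icc_self hxm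
    have h1 := (hx (by rw [uIcc_of_le hI]; exact hxI) a left_mem_uIcc).const_sub β
    refine h1.congr_of_eventuallyEq ?_
    filter_upwards [isOpen_Ioo.mem_nhds hxm] with y hy
    exact hPx τ y (Ioo_subset_Icc_self hy)
  · exact (hUx τ a ha).trans (by simp)
  · exact (hPx τ a ha).trans (by simp)
  · simp only [extend_apply hI _ hx]
    exact (continuous_eval_const (F := C(Icc a b, ℝ)) (⟨x, hx⟩ : Icc a b)).comp hUc
  · simp only [extend_apply hI _ hb]
    exact (continuous_eval_const (F := C(Icc a b, ℝ)) (⟨b, hb⟩ : Icc a b)).comp hPc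
  · have h1 : (fun τ => ∫ x in a..b, q₁ x * extend hI (U τ) x) =
        fun τ => volterra hI hq₁ hQ₁ (U τ) ⟨b, hb⟩ := rfl
    rw [h1]
    exact (continuous_eval_const (F := C(Icc a b, ℝ)) (⟨b, hb⟩ : Icc a b)).comp
      ((volterra hI hq₁ hQ₁).continuous.comp hUc)
  · have h1 : {τ | ∀ x ∈ Icc a b, 0 < extend hI (U τ) x} =
        U ⁻¹' {f : C(Icc a b, ℝ) | MapsTo f univ (Ioi 0)} := by
      ext τ
      simp only [mem_ofPred_eq, mem_preimage]
      exact ⟨fun h x _ => by have := h x x.2; rwa [extend_apply hI _ x.2] at this,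
        fun h x hx => by rw [extend_apply hI _ hx]; exact h (mem_univ _)⟩
    rw [h1]
    exact (ContinuousMap.isOpen_setOfPred_mapsTo isCompact_univ isOpen_Ioi).preimage hUc

/-- Shooting: between a parameter at which the initial value problem yields a strict positive
supersolution and one at which it does not, there is a parameter with a positive solution of the
boundary value problem. -/
theorem exists_positive_solution (hab : a < b) {β : ℝ} {q₀ q₁ : ℝ → ℝ} {Q₀ Q₁ : ℝ}
    (hQ₀ : ∀ x, |q₀ x| ≤ Q₀) (hQ₁ : ∀ x, |q₁ x| ≤ Q₁) {u p : ℝ → ℝ → ℝ}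
    (hs : ∀ τ, IsLinearSol a b (fun x => q₀ x + τ * q₁ x) (u τ) (p τ) ∧ u τ a = 1 ∧ p τ a = β)
    (hu : ∀ x ∈ Icc a b, Continuous fun τ => u τ x) (hp : Continuous fun τ => p τ b)
    (ho : IsOpen {τ | ∀ x ∈ Icc a b, 0 < u τ x}) {τ₀ τ₁ : ℝ} (hτ : τ₀ ≤ τ₁)
    (h₀ : (∀ x ∈ Icc a b, 0 < u τ₀ x) ∧ 0 < p τ₀ b + β * u τ₀ b)
    (h₁ : ¬((∀ x ∈ Icc a b, 0 < u τ₁ x) ∧ 0 < p τ₁ b + β * u τ₁ b)) :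
    ∃ σ, τ₀ < σ ∧ σ ≤ τ₁ ∧ (∀ x ∈ Icc a b, 0 < u σ x) ∧ p σ b = -β * u σ b := by
  have hb : b ∈ Icc a b := right_mem_Icc.2 hab.le
  have ha : a ∈ Icc a b := left_mem_Icc.2 hab.le
  have hF : Continuous fun τ => p τ b + β * u τ b := hp.add (continuous_const.mul (hu b hb))
  set O : Set ℝ := {τ | ∀ x ∈ Icc a b, 0 < u τ x} ∩ {τ | 0 < p τ b + β * u τ b} with hO
  have hOo : IsOpen O := ho.inter (isOpen_lt continuous_const hF)
  obtain ⟨σ, ⟨hσ, hσO⟩, hmin⟩ := (isCompact_Icc.diff hOo).exists_isLeast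
    (s := Icc τ₀ τ₁ \ O) ⟨τ₁, right_mem_Icc.2 hτ, h₁⟩
  have hlt : τ₀ < σ := lt_of_le_of_ne hσ.1 fun h => hσO (h ▸ h₀)
  have hbelow : ∀ τ ∈ Ico τ₀ σ, τ ∈ O := fun τ hτ' => by
    by_contra hc
    exact (hmin ⟨⟨hτ'.1, hτ'.2.le.trans hσ.2⟩, hc⟩).not_gt hτ'.2
  have hlim : ∀ g : ℝ → ℝ, Continuous g → (∀ τ ∈ O, 0 ≤ g τ) → 0 ≤ g σ := by
    intro g hg hpos
    have hcl : σ ∈ closure (Ico τ₀ σ) := by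
      rw [closure_Ico hlt.ne]; exact right_mem_Icc.2 hlt.le
    exact closure_minimal (fun τ hτ' => hpos τ (hbelow τ hτ') : Ico τ₀ σ ⊆ g ⁻¹' Ici 0)
      (isClosed_Ici.preimage hg) hcl
  have hnn : ∀ x ∈ Icc a b, 0 ≤ u σ x := fun x hx =>
    hlim _ (hu x hx) fun τ hτ' => (hτ'.1 x hx).le
  have hFn : 0 ≤ p σ b + β * u σ b := hlim _ hF fun τ hτ' => le_of_lt hτ'.2
  obtain ⟨hsol, hua, -⟩ := hs σ
  have hQ : ∀ᵐ x, x ∈ Ioo a b → |q₀ x + σ * q₁ x| ≤ Q₀ + |σ| * Q₁ := .of_forall fun x _ => by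
    refine (abs_add_le _ _).trans (add_le_add (hQ₀ x) ?_)
    rw [abs_mul]
    exact mul_le_mul_of_nonneg_left (hQ₁ x) (abs_nonneg _)
  have hnd : ∀ x ∈ Icc a b, u σ x = 0 → p σ x ≠ 0 := fun x hx h1 h2 => by
    have := hsol.eq_zero_of_double_zero hQ hx h1 h2 a ha
    rw [hua] at this
    exact one_ne_zero this
  have hpos : ∀ x ∈ Icc a b, 0 < u σ x := by
    intro x hx
    refine lt_of_le_of_ne (hnn x hx) fun h0 => ?_
    -- a zero of `u` is a minimum, hence a double zero
    have hxa : x ≠ a := fun h => by rw [h, hua] at h0; exact zero_ne_one h0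
    rcases hx.2.eq_or_lt with hxb | hxb
    · subst hxb
      refine hnd x hx h0.symm (le_antisymm ?_ (by simpa [← h0] using hFn))
      have h1 := hsol.hasDeriv x hx
      -- the difference quotients at the right endpoint are nonpositive
      have h2 : HasDerivWithinAt (u σ) (p σ x) (Iio x) x :=
        (h1.mono_of_mem_nhdsWithin (Icc_mem_nhdsLE hab)).mono Iio_subset_Iic_self
      rw [hasDerivWithinAt_iff_tendsto_slope' self_notMem_Iio] at h2
      refine le_of_tendsto h2 ?_
      filter_upwards [Ioo_mem_nhdsLT hab] with y hy
      rw [slope_def_field, ← h0, sub_zero]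
      exact div_nonpos_of_nonneg_of_nonpos (hnn y (Ioo_subset_Icc_self hy)) (by linarith [hy.2])
    · have hxm : x ∈ Ioo a b := ⟨lt_of_le_of_ne hx.1 hxa.symm, hxb⟩
      refine hnd x hx h0.symm ?_
      have hmin' : IsLocalMin (u σ) x := by
        filter_upwards [isOpen_Ioo.mem_nhds hxm] with y hy
        rw [← h0]; exact hnn y (Ioo_subset_Icc_self hy)
      exact hmin'.hasDerivAt_eq_zero (hsol.hasDerivAt hxm)
  refine ⟨σ, hlt, hσ.2, hpos, ?_⟩
  have : ¬0 < p σ b + β * u σ b := fun h => hσO ⟨hpos, h⟩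
  linarith

end Shooting

/-! ### Existence and uniqueness of the principal eigenvalue -/

/-- For a nonpositive potential the solution and its derivative do not decrease below their
initial values. -/
theorem IsLinearSol.one_le_of_nonpos {a b β : ℝ} {q u p : ℝ → ℝ} (h : IsLinearSol a b q u p)
    (hab : a ≤ b) (hq : ∀ x, q x ≤ 0) (hu : u a = 1) (hp : p a = β) (hβ : 0 ≤ β) :
    ∀ x ∈ Icc a b, 1 ≤ u x ∧ 0 ≤ p x := by
  have ha : a ∈ Icc a b := left_mem_Icc.2 hab
  have huac := h.ac hab
  have h1 := ac_antitoneOn (huac.mul h.absCont).neg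
    (f' := fun x => -(p x * p x + u x * (-(q x * u x)))) (by
      filter_upwards [h.eqn] with x hx hxm
      exact ((h.hasDerivAt hxm).mul (hx hxm)).neg) (.of_forall fun x _ => by
        nlinarith [mul_nonneg (neg_nonneg.2 (hq x)) (mul_self_nonneg (u x)), mul_self_nonneg (p x)])
  have hup : ∀ x ∈ Icc a b, 0 ≤ u x * p x := fun x hx => by
    have := h1 ha hx hx.1
    simp only [Pi.neg_apply, Pi.mul_apply, hu, hp] at this
    linarith
  have h2 := ac_antitoneOn (huac.mul huac).neg (f' := fun x => -(p x * u x + u x * p x))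
    (.of_forall fun x hxm => ((h.hasDerivAt hxm).mul (h.hasDerivAt hxm)).neg)
    (.of_forall fun x hxm => by linarith [hup x (Ioo_subset_Icc_self hxm)])
  have hsq : ∀ x ∈ Icc a b, 1 ≤ u x * u x := fun x hx => by
    have := h2 ha hx hx.1
    simp only [Pi.neg_apply, Pi.mul_apply, hu] at this
    linarith
  have hpos : ∀ x ∈ Icc a b, 1 ≤ u x := by
    intro x hx
    by_contra! hlt
    -- `u² ≥ 1` excludes the values in `(-1, 1)`, hence a change of sign
    have hneg : u x ≤ 0 := by nlinarith [hsq x hx]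
    obtain ⟨y, hy, hy0⟩ := intermediate_value_Icc' hx.1
      ((ac_continuousOn hab huac).mono (Icc_subset_Icc_right hx.2))
      (show (0 : ℝ) ∈ Icc (u x) (u a) from ⟨hneg, by rw [hu]; exact zero_le_one⟩)
    have := hsq y ⟨hy.1, hy.2.trans hx.2⟩
    rw [hy0] at this
    linarith
  exact fun x hx => ⟨hpos x hx, nonneg_of_mul_nonneg_right (hup x hx) (one_pos.trans_le (hpos x hx))⟩

theorem intervalIntegrable_of_bounded {m : ℝ → ℝ} {Q : ℝ} (hm : Measurable m)
    (hQ : ∀ x, |m x| ≤ Q) (x y : ℝ) : IntervalIntegrable m volume x y := by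
  simpa using intervalIntegrable_mul hm hQ (continuous_const (y := (1 : ℝ))) x y

/-- A function that is positive on a set of positive measure has a positive integral over some
interval. -/
theorem exists_integral_pos {a b Q : ℝ} {m : ℝ → ℝ} (hab : a < b) (hm : Measurable m)
    (hQ : ∀ x, |m x| ≤ Q) (hpos : ¬∀ᵐ x, x ∈ Ioo a b → m x ≤ 0) :
    ∃ s t, a ≤ s ∧ s ≤ t ∧ t ≤ b ∧ 0 < ∫ x in s..t, m x := by
  by_contra! hc
  have hi := intervalIntegrable_of_bounded hm hQ
  have hanti : AntitoneOn (fun x => ∫ t in a..x, m t) (Icc a b) := by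
    intro s hs t ht hst
    have h1 := hc s t hs.1 hst ht.2
    have h2 := intervalIntegral.integral_add_adjacent_intervals (hi a s) (hi s t)
    simp only
    linarith
  refine hpos ?_
  filter_upwards [(hi a b).ae_hasDerivAt_integral] with x hx hxm
  have hxI := Ioo_subset_Icc_self hxm
  have h1 := (hx (by rw [uIcc_of_le hab.le]; exact hxI) a left_mem_uIcc).hasDerivWithinAt
    (s := Icc a b)
  rw [← h1.derivWithin (uniqueDiffOn_Icc hab x hxI)]
  exact hanti.derivWithin_nonpos

/-- A bounded measurable weight in the range `[-1, κ]` of the weights under consideration. -/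
structure IsRegularWeight (κ : ℝ) (m : ℝ → ℝ) : Prop where
  measurable : Measurable m
  neg_one_le : ∀ x, -1 ≤ m x
  le : ∀ x, m x ≤ κ

theorem IsRegularWeight.abs_le {κ : ℝ} {m : ℝ → ℝ} (h : IsRegularWeight κ m) (x : ℝ) :
    |m x| ≤ 1 + |κ| := by
  rw [_root_.abs_le]
  constructor
  · linarith [h.neg_one_le x, abs_nonneg κ]
  · linarith [h.le x, le_abs_self κ]

/-- A large parameter admits no positive supersolution: the state stays in `[-√lam, √lam]`, while
an interval on which the weight has a positive integral forces a decrease of order `lam`. -/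
theorem mul_integral_le {a b β lam s t : ℝ} {m v : ℝ → ℝ} (hm1 : ∀ x, -1 ≤ m x)
    (hm : ∀ x y, IntervalIntegrable m volume x y)
    (h : IsRiccati a b (fun x => lam * m x) v) (hl : 0 < lam) (hβ : β ≤ √lam) (hva : v a = β)
    (hvb : -β ≤ v b) (has : a ≤ s) (hst : s ≤ t) (htb : t ≤ b) :
    lam * ∫ x in s..t, m x ≤ 2 * √lam := by
  have hsq := Real.sq_sqrt hl.le
  have hq : ∀ᵐ x, x ∈ Ioo a b → -(lam * m x) ≤ lam := .of_forall fun x _ => by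
    nlinarith [hm1 x]
  have h1 : v s ≤ √lam := h.le_of_le hq hsq.ge le_rfl has (hst.trans htb) (by linarith)
  have h2 : -√lam ≤ v t := by
    by_contra! hlt
    have := h.lt_of_lt hq (by rw [neg_sq, hsq]) (has.trans hst) htb le_rfl hlt
    linarith
  have hr := h.mono has hst htb
  obtain ⟨i1, h3⟩ := ac_integral_eq_sub hst hr.ac hr.deriv
  have h4 : ∫ x in s..t, (-(lam * m x) - v x ^ 2) ≤ ∫ x in s..t, -(lam * m x) :=
    intervalIntegral.integral_mono_on hst i1 ((hm s t).const_mul lam).neg fun x _ => by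
      linarith [sq_nonneg (v x)]
  rw [intervalIntegral.integral_neg, intervalIntegral.integral_const_mul] at h4
  linarith

/-- Existence of a positive principal eigenvalue, by shooting from the left endpoint. A strict positive
supersolution exists at a small parameter, where for `β = 0` the condition `∫ m < 0` enters, and not
at large parameters. -/
theorem exists_isPrincipalEigenvalue {a b β κ : ℝ} {m : ℝ → ℝ} (hab : a < b) (hβ : 0 ≤ β)
    (hm : IsRegularWeight κ m) (hpos : ¬∀ᵐ x, x ∈ Ioo a b → m x ≤ 0)
    (hint : β = 0 → ∫ x in a..b, m x < 0) : ∃ lam, IsPrincipalEigenvalue a b β m lam := by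
  have ha : a ∈ Icc a b := left_mem_Icc.2 hab.le
  have hb : b ∈ Icc a b := right_mem_Icc.2 hab.le
  have hQ0 : ∀ x : ℝ, |(fun _ : ℝ => (0 : ℝ)) x| ≤ 0 := by simp
  obtain ⟨u, p, hs, hu, hp, hup, ho⟩ := exists_linear_family hab β
    (measurable_const (a := (0 : ℝ))) hQ0 hm.measurable hm.abs_le
  have hsol0 := fun x hx => (hs 0).1.one_le_of_nonpos hab.le (by simp) (hs 0).2.1 (hs 0).2.2 hβ x hx
  -- a small parameter with a strict positive supersolution
  obtain ⟨τ₀, hτ₀, h₀⟩ : ∃ τ₀, 0 ≤ τ₀ ∧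
      (∀ x ∈ Icc a b, 0 < u τ₀ x) ∧ 0 < p τ₀ b + β * u τ₀ b := by
    rcases hβ.eq_or_lt with hβ0 | hβ0
    · -- here `u₀ = 1`, and `p_τ(b) = -τ ∫ m u_τ` with `∫ m u_τ → ∫ m < 0`
      subst hβ0
      have hac := (hs 0).1.absCont
      have hp0 : ∀ x ∈ Icc a b, p 0 x = 0 := by
        obtain ⟨C, hC⟩ : ∃ C, ∀ x ∈ Icc a b, p 0 x = C := by
          refine ⟨0, fun x hx => ?_⟩
          have h1 := (ac_integral_eq_sub hx.1 (ac_mono hac le_rfl hx.1 hx.2) (f' := fun _ => 0) (by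
            filter_upwards [(hs 0).1.eqn] with y hy hym
            simpa using hy ⟨hym.1, hym.2.trans_le hx.2⟩)).2
          rw [intervalIntegral.integral_zero, (hs 0).2.2] at h1
          linarith
        intro x hx
        rw [hC x hx, ← hC a ha, (hs 0).2.2]
      have hu0 : ∀ x ∈ Icc a b, u 0 x = 1 := by
        intro x hx
        have h1 := (ac_integral_eq_sub hx.1 (ac_mono ((hs 0).1.ac hab.le) le_rfl hx.1 hx.2)
          (f' := fun _ => 0) (.of_forall fun y hym => by
            have hy : y ∈ Ioo a b := ⟨hym.1, hym.2.trans_le hx.2⟩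
            have := (hs 0).1.hasDerivAt hy
            rwa [hp0 y (Ioo_subset_Icc_self hy)] at this)).2
        rw [intervalIntegral.integral_zero, (hs 0).2.1] at h1
        linarith
      have hneg : ∫ x in a..b, m x * u 0 x < 0 := by
        rw [intervalIntegral.integral_congr (g := m) fun x hx => ?_]
        · exact hint rfl
        · rw [uIcc_of_le hab.le] at hx
          simp only [hu0 x hx, mul_one]
      have hev : ∀ᶠ τ in nhds (0 : ℝ), (∀ x ∈ Icc a b, 0 < u τ x) ∧
          ∫ x in a..b, m x * u τ x < 0 :=
        Filter.Eventually.and (ho.mem_nhds fun x hx => one_pos.trans_le (hsol0 x hx).1)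
          (hup.continuousAt.eventually (gt_mem_nhds hneg))
      obtain ⟨τ, ⟨h1, h2⟩, h3⟩ := ((hev.filter_mono nhdsWithin_le_nhds).and
        (self_mem_nhdsWithin (s := Ioi (0 : ℝ)))).exists
      refine ⟨τ, le_of_lt h3, h1, ?_⟩
      have h4 := (ac_integral_eq_sub hab.le (hs τ).1.absCont (hs τ).1.eqn).2
      rw [(hs τ).2.2, intervalIntegral.integral_congr
        (g := fun x => -τ * (m x * u τ x)) (fun x _ => by ring),
        intervalIntegral.integral_const_mul] at h4
      have h5 : 0 < τ := h3
      nlinarith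
    · refine ⟨0, le_rfl, fun x hx => one_pos.trans_le (hsol0 x hx).1, ?_⟩
      have h1 := hsol0 b hb
      nlinarith
  obtain ⟨s, t, has, hst, htb, hI⟩ := exists_integral_pos hab hm.measurable hm.abs_le hpos
  set I := ∫ x in s..t, m x with hIdef
  -- at the parameter `r²` one has `r ≥ β` and `r * I > 2`, which excludes a supersolution
  set r := τ₀ + β + 2 / I + 1 with hr
  have hr1 : 1 ≤ r := by have := div_pos two_pos hI; linarith
  have hrsq : √(r ^ 2) = r := Real.sqrt_sq (by linarith)
  have h2I : 0 < 2 / I := div_pos two_pos hI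
  obtain ⟨σ, hσ0, -, hσpos, hσb⟩ := exists_positive_solution hab hQ0 hm.abs_le hs hu hp ho
    (τ₀ := τ₀) (τ₁ := r ^ 2) (by nlinarith) h₀ (by
      rintro ⟨h1, h2⟩
      have hR := (hs (r ^ 2)).1.isRiccati hab.le h1
      simp only [zero_add] at hR
      have hub := h1 b hb
      have := mul_integral_le (β := β) hm.neg_one_le (intervalIntegrable_of_bounded hm.measurable hm.abs_le)
        hR (by positivity) (by rw [hrsq]; linarith) (by rw [(hs _).2.1, (hs _).2.2, div_one])
        (by rw [le_div_iff₀ hub]; linarith) has hst htb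
      rw [hrsq, ← hIdef] at this
      have h3 : 2 / I * I = 2 := by field_simp
      have h4 : r * I ≤ 2 := by nlinarith
      nlinarith)
  have hL := (hs σ).1
  simp only [zero_add] at hL
  exact ⟨σ, hτ₀.trans_lt hσ0, u σ, p σ, hL.isPositiveEigenfunction hσpos
    (by rw [(hs σ).2.1, (hs σ).2.2, mul_one]) hσb⟩

theorem IsPrincipalEigenvalue.unique {a b β κ lam₁ lam₂ : ℝ} {m : ℝ → ℝ} (hab : a < b) (hβ : 0 ≤ β)
    (hm : IsRegularWeight κ m) (hpos : ¬∀ᵐ x, x ∈ Ioo a b → m x ≤ 0)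
    (h₁ : IsPrincipalEigenvalue a b β m lam₁) (h₂ : IsPrincipalEigenvalue a b β m lam₂) :
    lam₁ = lam₂ := by
  wlog hlt : lam₁ < lam₂ generalizing lam₁ lam₂
  · rcases (not_lt.1 hlt).eq_or_lt with h | h
    · exact h.symm
    · exact (this h₂ h₁ h).symm
  obtain ⟨hl1, u1, p1, e1⟩ := h₁
  obtain ⟨hl2, u2, p2, e2⟩ := h₂
  obtain ⟨v1, r1, a1, b1⟩ := e1.exists_isRiccati hab hm.abs_le
  obtain ⟨v2, r2, a2, b2⟩ := e2.exists_isRiccati hab hm.abs_le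
  refine absurd ?_ hpos
  filter_upwards [ae_eq_zero_of_supersolution hab hβ r1 r2 hl1 hlt a1 b1 a2 b2.ge] with x hx hxm
  exact (hx hxm).le

theorem isControlled_of_isRiccati {a b lam κ : ℝ} {m v : ℝ → ℝ} (hκ : 0 < κ)
    (hm : IsRegularWeight κ m) (h : IsRiccati a b (fun x => lam * m x) v) :
    IsControlled a b lam κ (fun x => (1 + m x) / (1 + κ)) v := by
  have hk : 0 < 1 + κ := by linarith
  refine ⟨?_, .of_forall fun x _ => ⟨?_, ?_⟩, ?_⟩
  · convert h using 3 with x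
    field_simp
    ring
  · have := hm.neg_one_le x
    exact div_nonneg (by linarith) hk.le
  · have := hm.le x
    rw [div_le_one hk]; linarith
  · exact (intervalIntegrable_const.add
      (intervalIntegrable_of_bounded hm.measurable hm.abs_le a b)).div_const _

/-- If at the parameter `lamS` every control joining `β` to `-β` costs at least `l`, then weights
of cost at most `l` have principal eigenvalue at least `lamS`: otherwise a proper multiple of the
control would join the same states at the parameter `lamS` for less than `l`. -/
theorem le_of_forall_isControlled {a b β κ lam lamS l : ℝ} {m : ℝ → ℝ} (hab : a < b) (hβ : 0 ≤ β)
    (hκ : 0 < κ) (hm : IsRegularWeight κ m) (hpos : ¬∀ᵐ x, x ∈ Ioo a b → m x ≤ 0) (hl : 0 < l)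
    (hlS : 0 < lamS)
    (hS : ∀ θ v, IsControlled a b lamS κ θ v → v a = β → v b = -β → l ≤ ∫ x in a..b, θ x)
    (hcost : ∫ x in a..b, (1 + m x) / (1 + κ) ≤ l) (h : IsPrincipalEigenvalue a b β m lam) :
    lamS ≤ lam := by
  by_contra! hlt
  obtain ⟨hlam, u1, p1, e1⟩ := h
  obtain ⟨v1, r1, a1, b1⟩ := e1.exists_isRiccati hab hm.abs_le
  have ha : a ∈ Icc a b := left_mem_Icc.2 hab.le
  have hb : b ∈ Icc a b := right_mem_Icc.2 hab.le
  have hk : 0 < 1 + κ := by linarith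
  have hQ0 : ∀ x : ℝ, |(fun _ : ℝ => -lamS) x| ≤ lamS := by simp [abs_of_pos hlS]
  have hQ1 : ∀ x, |lamS * (1 + m x)| ≤ lamS * (1 + κ) := fun x => by
    rw [abs_of_nonneg (mul_nonneg hlS.le (by linarith [hm.neg_one_le x]))]
    exact mul_le_mul_of_nonneg_left (by linarith [hm.le x]) hlS.le
  have hM : Measurable fun x => lamS * (1 + m x) := (hm.measurable.const_add 1).const_mul lamS
  obtain ⟨u, p, hs, hu, hp, -, ho⟩ := exists_linear_family hab β
    (measurable_const (a := -lamS)) hQ0 hM hQ1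
  -- `u_τ`, `p_τ` solve the equation with the control of `m` scaled by `τ`; at `τ = 1` there is no
  -- positive supersolution, because `lamS` lies above the eigenvalue
  have hnot : ∀ h1 : (∀ x ∈ Icc a b, 0 < u 1 x), 0 ≤ p 1 b + β * u 1 b → False := by
    intro h1 h2
    have hR := (hs 1).1.isRiccati hab.le h1
    have hR' : IsRiccati a b (fun x => lamS * m x) (fun x => p 1 x / u 1 x) := by
      convert hR using 2 with x
      ring
    refine hpos ?_
    filter_upwards [ae_eq_zero_of_supersolution hab hβ r1 hR' hlam hlt a1 b1
      (by rw [(hs 1).2.1, (hs 1).2.2, div_one])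
      (by rw [le_div_iff₀ (h1 b hb)]; linarith)] with x hx hxm
    exact (hx hxm).le
  have hsol0 := fun x hx => (hs 0).1.one_le_of_nonpos hab.le (by simp [hlS.le]) (hs 0).2.1
    (hs 0).2.2 hβ x hx
  obtain ⟨σ, hσ0, hσ1, hσpos, hσb⟩ := exists_positive_solution hab hQ0 hQ1 hs hu hp ho
    (τ₀ := 0) (τ₁ := 1) zero_le_one
    ⟨fun x hx => one_pos.trans_le (hsol0 x hx).1, by
      have h1 := ac_strictAntiOn (hs 0).1.absCont.neg
        ((hs 0).1.eqn.mono fun x hx hxm => (hx hxm).neg) (.of_forall fun x hxm => by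
          have := (hsol0 x (Ioo_subset_Icc_self hxm)).1
          nlinarith) ha hb hab
      simp only [Pi.neg_apply, (hs 0).2.2] at h1
      have h2 := mul_nonneg hβ (zero_le_one.trans (hsol0 b hb).1)
      linarith⟩
    fun h1 => hnot h1.1 h1.2.le
  have hσ1' : σ < 1 := lt_of_le_of_ne hσ1 fun h1 => by
    subst h1
    exact hnot hσpos (by linarith)
  have hR := (hs σ).1.isRiccati hab.le hσpos
  have hC := isControlled_of_isRiccati (a := a) (b := b) hκ hm r1
  have hC' : IsControlled a b lamS κ (fun x => σ * ((1 + m x) / (1 + κ)))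
      (fun x => p σ x / u σ x) := by
    refine ⟨?_, ?_, hC.integrable.const_mul σ⟩
    · convert hR using 2 with x
      field_simp
      ring
    · filter_upwards [hC.range] with x hx hxm
      have := hx hxm
      constructor <;> nlinarith
  have h1 := hS _ _ hC' (by rw [(hs σ).2.1, (hs σ).2.2, div_one])
    (by rw [hσb]; have := (hσpos b hb).ne'; field_simp)
  rw [intervalIntegral.integral_const_mul] at h1
  nlinarith

/-! ### Weights and sets -/

section

variable {a b β κ m₀ c lam : ℝ} {m m' : ℝ → ℝ}

theorem IsPrincipalEigenvalue.congr (h : m =ᵐ[volume.restrict (Ioo a b)] m')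
    (hm : IsPrincipalEigenvalue a b β m lam) : IsPrincipalEigenvalue a b β m' lam := by
  obtain ⟨hl, u, p, e⟩ := hm
  refine ⟨hl, u, p, e.pos, e.hasDeriv, e.absCont, ?_, e.left, e.right⟩
  filter_upwards [e.eqn, h] with x h1 h2
  rwa [← h2]

theorem principalEigenvalue_congr (h : m =ᵐ[volume.restrict (Ioo a b)] m') :
    principalEigenvalue a b β m = principalEigenvalue a b β m' := by
  unfold principalEigenvalue
  congr 1
  ext lam
  exact ⟨IsPrincipalEigenvalue.congr h, IsPrincipalEigenvalue.congr h.symm⟩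

theorem IsAdmissibleWeight.congr (h : m =ᵐ[volume.restrict (Ioo a b)] m')
    (hm : IsAdmissibleWeight a b κ m₀ m) : IsAdmissibleWeight a b κ m₀ m' := by
  refine ⟨hm.aemeasurable.congr h, ?_, ?_, ?_⟩
  · filter_upwards [hm.bounds, h] with x h1 h2
    rwa [← h2]
  · refine hm.pos_part.trans_eq (measure_congr ?_)
    filter_upwards [h] with x hx
    exact propext (by change 0 < m x ↔ 0 < m' x; rw [hx])
  · rw [← integral_congr_ae h]
    exact hm.integral_le

theorem IsAdmissibleWeight.exists_regular (hκ : 0 < κ) (hm : IsAdmissibleWeight a b κ m₀ m) :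
    ∃ m', IsRegularWeight κ m' ∧ m =ᵐ[volume.restrict (Ioo a b)] m' := by
  obtain ⟨g, hg, hmg⟩ := hm.aemeasurable
  refine ⟨fun x => max (-1) (min κ (g x)), ⟨by fun_prop, fun x => le_max_left _ _, fun x =>
    max_le (by linarith) (min_le_left _ _)⟩, ?_⟩
  filter_upwards [hmg, hm.bounds] with x h1 h2
  rw [← h1, min_eq_right h2.2, max_eq_right h2.1]

theorem IsAdmissibleWeight.not_ae_nonpos (hm : IsAdmissibleWeight a b κ m₀ m) :
    ¬∀ᵐ x, x ∈ Ioo a b → m x ≤ 0 := by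
  intro h
  rw [← ae_restrict_iff' measurableSet_Ioo, ae_iff] at h
  simp only [not_le] at h
  exact hm.pos_part.ne' h

theorem integral_Ioo_eq (hab : a ≤ b) (f : ℝ → ℝ) : ∫ x in Ioo a b, f x = ∫ x in a..b, f x := by
  rw [intervalIntegral.integral_of_le hab, integral_Ioc_eq_integral_Ioo]

/-- The control of an admissible weight costs at most `c (b - a)`. -/
theorem IsAdmissibleWeight.cost_le (hab : a < b) (hκ : 0 < κ) (hc : c = (1 - m₀) / (1 + κ))
    (hr : IsRegularWeight κ m) (hm : IsAdmissibleWeight a b κ m₀ m) :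
    ∫ x in a..b, (1 + m x) / (1 + κ) ≤ c * (b - a) := by
  have h1 := hm.integral_le
  rw [integral_Ioo_eq hab.le] at h1
  rw [intervalIntegral.integral_div, intervalIntegral.integral_add intervalIntegrable_const
    (intervalIntegrable_of_bounded hr.measurable hr.abs_le a b), intervalIntegral.integral_const,
    hc, div_mul_eq_mul_div]
  refine div_le_div_of_nonneg_right ?_ (by linarith)
  simp only [smul_eq_mul, mul_one]
  linarith

theorem IsAdmissibleWeight.exists_isPrincipalEigenvalue (hab : a < b) (hβ : 0 ≤ β) (hκ : 0 < κ)
    (hβm : β = 0 → 0 < m₀) (hm : IsAdmissibleWeight a b κ m₀ m) :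
    ∃ lam, IsPrincipalEigenvalue a b β m lam ∧ principalEigenvalue a b β m = lam := by
  obtain ⟨m', hr, hmm⟩ := hm.exists_regular hκ
  have hm' := hm.congr hmm
  obtain ⟨lam, hlam⟩ := RobinWeight.exists_isPrincipalEigenvalue hab hβ hr hm'.not_ae_nonpos
    fun h0 => by
      have h1 := hm'.integral_le
      rw [integral_Ioo_eq hab.le] at h1
      have := mul_pos (hβm h0) (sub_pos.2 hab)
      linarith
  refine ⟨lam, hlam.congr hmm.symm, ?_⟩
  have : {l | IsPrincipalEigenvalue a b β m' l} = {lam} := by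
    ext l
    exact ⟨fun h => IsPrincipalEigenvalue.unique hab hβ hr hm'.not_ae_nonpos h hlam,
      fun h => by rw [mem_singleton_iff.1 h]; exact hlam⟩
  rw [principalEigenvalue_congr hmm, principalEigenvalue, this, csInf_singleton]

theorem setWeight_apply {E : Set ℝ} {x : ℝ} (hx : x ∈ Ioo a b) :
    setWeight a b κ E x = (1 + κ) * E.indicator 1 x - 1 := by
  by_cases h : x ∈ E
  · simp [setWeight, h]
  · simp [setWeight, h, hx]

theorem setWeight_ae_eq_iff {E F : Set ℝ} (hκ : 0 < κ) (hE : E ⊆ Ioo a b) (hF : F ⊆ Ioo a b) :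
    setWeight a b κ E =ᵐ[volume.restrict (Ioo a b)] setWeight a b κ F ↔ E =ᵐ[volume] F := by
  rw [Filter.EventuallyEq, ae_restrict_iff' measurableSet_Ioo]
  constructor
  · intro h
    filter_upwards [h] with x hx
    refine propext ?_
    change x ∈ E ↔ x ∈ F
    by_cases hxm : x ∈ Ioo a b
    · have h1 := hx hxm
      rw [setWeight_apply hxm, setWeight_apply hxm] at h1
      have h2 : E.indicator (1 : ℝ → ℝ) x = F.indicator 1 x :=
        mul_left_cancel₀ (by linarith : 1 + κ ≠ 0) (by linarith)
      by_cases hxE : x ∈ E <;> by_cases hxF : x ∈ F <;> simp_all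
    · exact ⟨fun h => absurd (hE h) hxm, fun h => absurd (hF h) hxm⟩
  · intro h
    filter_upwards [h] with x hx hxm
    have h1 : x ∈ E ↔ x ∈ F := iff_of_eq hx
    rw [setWeight_apply hxm, setWeight_apply hxm]
    by_cases hxE : x ∈ E
    · simp [hxE, h1.1 hxE]
    · have hxF : x ∉ F := fun h => hxE (h1.2 h)
      simp [hxE, hxF]

theorem isRegularWeight_setWeight {E : Set ℝ} (hκ : 0 < κ) (hE : MeasurableSet E)
    (hEs : E ⊆ Ioo a b) : IsRegularWeight κ (setWeight a b κ E) := by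
  refine ⟨?_, fun x => ?_, fun x => ?_⟩
  · unfold setWeight
    exact ((measurable_one.indicator hE).const_mul κ).sub
      (measurable_one.indicator (measurableSet_Ioo.diff hE))
  all_goals
    by_cases hx : x ∈ Ioo a b
    · rw [setWeight_apply hx]
      by_cases h : x ∈ E
      · simp [h]; try linarith
      · simp [h]; try linarith
    · have h : x ∉ E := fun h => hx (hEs h)
      have h' : x ∉ Ioo a b \ E := fun h => hx h.1
      rw [setWeight, indicator_of_notMem h, indicator_of_notMem h']
      linarith

theorem IsAdmissibleSet.isAdmissibleWeight {E : Set ℝ} (hab : a < b) (hκ : 0 < κ) (hm₁ : m₀ < 1)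
    (hc : c = (1 - m₀) / (1 + κ)) (hE : IsAdmissibleSet a b c E) :
    IsAdmissibleWeight a b κ m₀ (setWeight a b κ E) := by
  have hr := isRegularWeight_setWeight hκ hE.measurable hE.subset
  refine ⟨hr.measurable.aemeasurable, .of_forall fun x => ⟨hr.neg_one_le x, hr.le x⟩, ?_, ?_⟩
  · rw [Measure.restrict_apply (measurableSet_lt measurable_const hr.measurable)]
    refine hE.pos.trans_le (measure_mono fun x hx => ⟨?_, hE.subset hx⟩)
    change 0 < setWeight a b κ E x
    rw [setWeight_apply (hE.subset hx)]
    simp [hx, hκ]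
  · rw [setIntegral_congr_fun measurableSet_Ioo fun x hx => setWeight_apply (κ := κ) hx,
      integral_sub, integral_const_mul, setIntegral_indicator hE.measurable]
    · have h1 : Ioo a b ∩ E = E := inter_eq_right.2 hE.subset
      have h2 : volume.real E ≤ c * (b - a) := by
        refine ENNReal.toReal_le_of_le_ofReal ?_ hE.le
        rw [hc]
        exact mul_nonneg (div_nonneg (by linarith) (by linarith)) (by linarith)
      have h3 : (1 + κ) * c = 1 - m₀ := by rw [hc]; field_simp
      rw [h1]
      simp only [Pi.one_apply, integral_const, smul_eq_mul, mul_one, MeasurableSet.univ,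
        measureReal_restrict_apply, univ_inter, Real.volume_real_Ioo_of_le hab.le]
      have h4 := mul_le_mul_of_nonneg_left h2 (by linarith : 0 ≤ 1 + κ)
      rw [← mul_assoc, h3] at h4
      linarith
    · exact ((integrable_const (1 : ℝ)).indicator hE.measurable).const_mul _
    · exact integrable_const _

theorem isAdmissibleSet_of_ae_eq_Ioo {E : Set ℝ} {s t : ℝ} (hE : MeasurableSet E)
    (hEs : E ⊆ Ioo a b) (hst : s < t) (hl : t - s = c * (b - a)) (h : E =ᵐ[volume] Ioo s t) :
    IsAdmissibleSet a b c E := by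
  have hv : volume E = ENNReal.ofReal (t - s) := by rw [measure_congr h, Real.volume_Ioo]
  exact ⟨hE, hEs, by rw [hv, ENNReal.ofReal_pos]; linarith, by rw [hv, hl]⟩

/-- If the minimum over the admissible weights is `lamS`, attained exactly by the weights of a
family of intervals of length `c (b - a)`, then this family describes all optimal sets and all
optimal weights. -/
theorem optimal_iff_of_family (hab : a < b) (hβ : 0 ≤ β) (hκ : 0 < κ) (hm₁ : m₀ < 1)
    (hβm : β = 0 → 0 < m₀) (hc : c = (1 - m₀) / (1 + κ)) {Fam : ℝ → ℝ → Prop} {lamS : ℝ}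
    (hFam : ∀ s t, Fam s t → a ≤ s ∧ t ≤ b ∧ t - s = c * (b - a)) (hne : ∃ s t, Fam s t)
    (hev : ∀ s t, Fam s t → IsPrincipalEigenvalue a b β (setWeight a b κ (Ioo s t)) lamS)
    (hmin : ∀ w lam, IsAdmissibleWeight a b κ m₀ w → IsPrincipalEigenvalue a b β w lam →
      lamS ≤ lam ∧ (lam = lamS →
        ∃ s t, Fam s t ∧ w =ᵐ[volume.restrict (Ioo a b)] setWeight a b κ (Ioo s t))) :
    (∀ E : Set ℝ, MeasurableSet E → E ⊆ Ioo a b →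
      (IsOptimalSet a b β κ c E ↔ ∃ s t, Fam s t ∧ E =ᵐ[volume] Ioo s t)) ∧
    ∀ w : ℝ → ℝ, IsOptimalWeight a b β κ m₀ w ↔
      ∃ E : Set ℝ, IsOptimalSet a b β κ c E ∧
        w =ᵐ[volume.restrict (Ioo a b)] setWeight a b κ E := by
  have hba := sub_pos.2 hab
  have hcL : 0 < c * (b - a) := by
    rw [hc]; exact mul_pos (div_pos (by linarith) (by linarith)) hba
  have hsub : ∀ s t, Fam s t → Ioo s t ⊆ Ioo a b := fun s t h =>
    Ioo_subset_Ioo (hFam s t h).1 (hFam s t h).2.1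
  have hlt : ∀ s t, Fam s t → s < t := fun s t h => by linarith [(hFam s t h).2.2]
  have hadm : ∀ s t, Fam s t → IsAdmissibleSet a b c (Ioo s t) := fun s t h =>
    isAdmissibleSet_of_ae_eq_Ioo measurableSet_Ioo (hsub s t h) (hlt s t h) (hFam s t h).2.2
      Filter.EventuallyEq.rfl
  have hpe : ∀ w, IsAdmissibleWeight a b κ m₀ w → lamS ≤ principalEigenvalue a b β w ∧
      (principalEigenvalue a b β w = lamS ↔
        ∃ s t, Fam s t ∧ w =ᵐ[volume.restrict (Ioo a b)] setWeight a b κ (Ioo s t)) := by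
    intro w hw
    obtain ⟨lam, h1, h2⟩ := hw.exists_isPrincipalEigenvalue hab hβ hκ hβm
    rw [h2]
    refine ⟨(hmin w lam hw h1).1, (hmin w lam hw h1).2, ?_⟩
    rintro ⟨s, t, hF, hwE⟩
    have hw' := ((hadm s t hF).isAdmissibleWeight hab hκ hm₁ hc)
    obtain ⟨lam', h3, h4⟩ := hw'.exists_isPrincipalEigenvalue hab hβ hκ hβm
    have hr := isRegularWeight_setWeight hκ measurableSet_Ioo (hsub s t hF)
    rw [← h2, principalEigenvalue_congr hwE, h4]
    exact h3.unique hab hβ hr hw'.not_ae_nonpos (hev s t hF)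
  have hset : ∀ E : Set ℝ, MeasurableSet E → E ⊆ Ioo a b →
      (IsOptimalSet a b β κ c E ↔ ∃ s t, Fam s t ∧ E =ᵐ[volume] Ioo s t) := by
    intro E hE hEs
    constructor
    · rintro ⟨hA, hopt⟩
      obtain ⟨s, t, hF⟩ := hne
      have hw := hA.isAdmissibleWeight hab hκ hm₁ hc
      have hI := (hpe _ ((hadm s t hF).isAdmissibleWeight hab hκ hm₁ hc)).2.2
        ⟨s, t, hF, Filter.EventuallyEq.rfl⟩
      have h1 := hopt _ (hadm s t hF)
      rw [hI] at h1
      obtain ⟨s', t', hF', h2⟩ := (hpe _ hw).2.1 (le_antisymm h1 (hpe _ hw).1)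
      exact ⟨s', t', hF', (setWeight_ae_eq_iff hκ hEs (hsub _ _ hF')).1 h2⟩
    · rintro ⟨s, t, hF, h1⟩
      have hA := isAdmissibleSet_of_ae_eq_Ioo hE hEs (hlt s t hF) (hFam s t hF).2.2 h1
      refine ⟨hA, fun F hFa => ?_⟩
      rw [(hpe _ (hA.isAdmissibleWeight hab hκ hm₁ hc)).2.2
        ⟨s, t, hF, (setWeight_ae_eq_iff hκ hEs (hsub _ _ hF)).2 h1⟩]
      exact (hpe _ (hFa.isAdmissibleWeight hab hκ hm₁ hc)).1
  refine ⟨hset, fun w => ⟨?_, ?_⟩⟩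
  · rintro ⟨hA, hopt⟩
    obtain ⟨s, t, hF⟩ := hne
    have hI := (hadm s t hF).isAdmissibleWeight hab hκ hm₁ hc
    have h1 := hopt _ hI
    rw [(hpe _ hI).2.2 ⟨s, t, hF, Filter.EventuallyEq.rfl⟩] at h1
    obtain ⟨s', t', hF', h2⟩ := (hpe _ hA).2.1 (le_antisymm h1 (hpe _ hA).1)
    exact ⟨Ioo s' t', (hset _ measurableSet_Ioo (hsub _ _ hF')).2
      ⟨s', t', hF', Filter.EventuallyEq.rfl⟩, h2⟩
  · rintro ⟨E, hE, hwE⟩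
    obtain ⟨s, t, hF, h1⟩ := (hset E hE.1.measurable hE.1.subset).1 hE
    have hwI := hwE.trans ((setWeight_ae_eq_iff hκ hE.1.subset (hsub _ _ hF)).2 h1)
    have hA := (hE.1.isAdmissibleWeight hab hκ hm₁ hc).congr hwE.symm
    refine ⟨hA, fun w' hw' => ?_⟩
    rw [(hpe _ hA).2.2 ⟨s, t, hF, hwI⟩]
    exact (hpe _ hw').1

/-- Reduction of the minimality among the weights to minimality among the controls at the
parameter `lamS`. -/
theorem min_weight_of_min_control (hab : a < b) (hβ : 0 ≤ β) (hκ : 0 < κ) (hm₁ : m₀ < 1)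
    (hc : c = (1 - m₀) / (1 + κ)) {Fam : ℝ → ℝ → Prop} {lamS : ℝ} (hlS : 0 < lamS)
    (hS : ∀ θ v, IsControlled a b lamS κ θ v → v a = β → v b = -β →
      c * (b - a) ≤ ∫ x in a..b, θ x ∧ (∫ x in a..b, θ x ≤ c * (b - a) →
        ∃ s t, Fam s t ∧ ∀ᵐ x, x ∈ Ioo a b → θ x = (Ioo s t).indicator 1 x))
    (w : ℝ → ℝ) (lam : ℝ) (hw : IsAdmissibleWeight a b κ m₀ w)
    (hlam : IsPrincipalEigenvalue a b β w lam) :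
    lamS ≤ lam ∧ (lam = lamS →
      ∃ s t, Fam s t ∧ w =ᵐ[volume.restrict (Ioo a b)] setWeight a b κ (Ioo s t)) := by
  have hk : 0 < 1 + κ := by linarith
  have hcL : 0 < c * (b - a) := by
    rw [hc]; exact mul_pos (div_pos (by linarith) (by linarith)) (sub_pos.2 hab)
  obtain ⟨m', hr, hwm⟩ := hw.exists_regular hκ
  have hm' := hw.congr hwm
  have hlam' := hlam.congr hwm
  have hcost := hm'.cost_le hab hκ hc hr
  refine ⟨le_of_forall_isControlled hab hβ hκ hr hm'.not_ae_nonpos hcL hlS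
    (fun θ v h h1 h2 => (hS θ v h h1 h2).1) hcost hlam', ?_⟩
  rintro rfl
  obtain ⟨-, u, p, e⟩ := hlam'
  obtain ⟨v, hR, hva, hvb⟩ := e.exists_isRiccati hab hr.abs_le
  obtain ⟨s, t, hF, h1⟩ := (hS _ v (isControlled_of_isRiccati hκ hr hR) hva hvb).2 hcost
  refine ⟨s, t, hF, hwm.trans ?_⟩
  rw [Filter.EventuallyEq, ae_restrict_iff' measurableSet_Ioo]
  filter_upwards [h1] with x hx hxm
  rw [setWeight_apply hxm, ← hx hxm]
  field_simp
  ring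

/-- The origin of the threshold: the descent from `√lam` to `-√lam` takes `c (b - a)` exactly if
`√lam = betaStar c κ / (b - a)`. -/
theorem two_mul_descentTime_sqrt (hκ : 0 < κ) (hc : 0 < c) (hl : 0 < lam) :
    2 * descentTime lam κ (√lam) = betaStar c κ * c / √lam := by
  have h1 := Real.sqrt_pos.2 hl
  have h2 := Real.sqrt_pos.2 hκ
  rw [descentTime, betaStar, Real.sqrt_mul hl.le, div_mul_cancel_left₀ h1.ne', one_div]
  field_simp

/-- The weight of an interval of length `c (b - a)` has a principal eigenvalue `lam`, and the
order of `√lam` and `β` is determined by the order of `β` and the threshold. -/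
theorem exists_eigenvalue_of_interval (hab : a < b) (hβ : 0 ≤ β) (hκ : 0 < κ) (hm₁ : m₀ < 1)
    (hβm : β = 0 → 0 < m₀) (hc : c = (1 - m₀) / (1 + κ)) {s t : ℝ} (has : a ≤ s) (htb : t ≤ b)
    (hst : t - s = c * (b - a)) :
    ∃ lam v, 0 < lam ∧ IsPrincipalEigenvalue a b β (setWeight a b κ (Ioo s t)) lam ∧
      IsControlled a b lam κ (fun x => (1 + setWeight a b κ (Ioo s t) x) / (1 + κ)) v ∧
      v a = β ∧ v b = -β ∧
      (∀ᵐ x, x ∈ Ioo a s → (1 + setWeight a b κ (Ioo s t) x) / (1 + κ) = 0) ∧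
      (∀ᵐ x, x ∈ Ioo s t → (1 + setWeight a b κ (Ioo s t) x) / (1 + κ) = 1) ∧
      (∀ᵐ x, x ∈ Ioo t b → (1 + setWeight a b κ (Ioo s t) x) / (1 + κ) = 0) ∧
      (β ≤ √lam → √lam ≤ betaStar c κ / (b - a)) ∧
      (√lam ≤ β → betaStar c κ / (b - a) ≤ √lam) := by
  have hba := sub_pos.2 hab
  have hk : 0 < 1 + κ := by linarith
  have hc0 : 0 < c := by rw [hc]; exact div_pos (by linarith) hk
  have hlt : s < t := by linarith [mul_pos hc0 hba]
  have hsub : Ioo s t ⊆ Ioo a b := Ioo_subset_Ioo has htb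
  have hw := (isAdmissibleSet_of_ae_eq_Ioo measurableSet_Ioo hsub hlt hst
    Filter.EventuallyEq.rfl).isAdmissibleWeight hab hκ hm₁ hc
  have hr := isRegularWeight_setWeight hκ (measurableSet_Ioo (a := s) (b := t)) hsub
  obtain ⟨lam, hlam, -⟩ := hw.exists_isPrincipalEigenvalue hab hβ hκ hβm
  obtain ⟨hl, u, p, e⟩ := id hlam
  obtain ⟨v, hR, hva, hvb⟩ := e.exists_isRiccati hab hr.abs_le
  have hC := isControlled_of_isRiccati hκ hr hR
  have z0 : ∀ x ∈ Ioo a b, x ∉ Ioo s t → (1 + setWeight a b κ (Ioo s t) x) / (1 + κ) = 0 :=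
    fun x hx hxm => by rw [setWeight_apply hx, indicator_of_notMem hxm]; simp
  have z1 : ∀ x ∈ Ioo s t, (1 + setWeight a b κ (Ioo s t) x) / (1 + κ) = 1 :=
    fun x hx => by
      rw [setWeight_apply (hsub hx), indicator_of_mem hx]
      simp only [Pi.one_apply, mul_one, add_sub_cancel]
      exact div_self hk.ne'
  have y0 : ∀ᵐ x, x ∈ Ioo a s → (1 + setWeight a b κ (Ioo s t) x) / (1 + κ) = 0 :=
    .of_forall fun x hx => z0 x ⟨hx.1, hx.2.trans (hlt.trans_le htb)⟩ fun h => h.1.not_gt hx.2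
  have y1 : ∀ᵐ x, x ∈ Ioo s t → (1 + setWeight a b κ (Ioo s t) x) / (1 + κ) = 1 :=
    .of_forall z1
  have y2 : ∀ᵐ x, x ∈ Ioo t b → (1 + setWeight a b κ (Ioo s t) x) / (1 + κ) = 0 :=
    .of_forall fun x hx => z0 x ⟨(has.trans_lt hlt).trans hx.1, hx.2⟩ fun h => h.2.not_gt hx.1
  have hsl := Real.sqrt_pos.2 hl
  have hT := two_mul_descentTime_sqrt hκ hc0 hl
  refine ⟨lam, v, hl, hlam, hC, hva, hvb, y0, y1, y2, fun h => ?_, fun h => ?_⟩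
  · have h1 := hC.length_le hl hκ has hlt.le htb hva hvb y1 h
    rw [hT, hst, le_div_iff₀ hsl] at h1
    rw [le_div_iff₀ hba]
    exact le_of_mul_le_mul_left (by linarith) hc0
  · have h1 := hC.le_length hl hκ has hlt.le htb hva hvb y0 y1 y2 h
    rw [hT, hst, div_le_iff₀ hsl] at h1
    rw [div_le_iff₀ hba]
    exact le_of_mul_le_mul_left (by linarith) hc0

end

/-! ### The three regimes -/

section

variable {a b β κ m₀ c : ℝ}

/-- Above the threshold `√lam < β`, and the centred interval is the only optimal one. -/
theorem optimal_iff_centered (hab : a < b) (hκ : 0 < κ) (hm₀ : -κ < m₀) (hm₁ : m₀ < 1)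
    (hβ : 0 ≤ β) (hβm : β = 0 → 0 < m₀) (hc : c = (1 - m₀) / (1 + κ))
    (h : betaStar c κ / (b - a) < β) :
    (∀ E : Set ℝ, MeasurableSet E → E ⊆ Ioo a b →
      (IsOptimalSet a b β κ c E ↔ ∃ s t, (s = (a + b) / 2 - c * (b - a) / 2 ∧
        t = (a + b) / 2 + c * (b - a) / 2) ∧ E =ᵐ[volume] Ioo s t)) ∧
    ∀ w : ℝ → ℝ, IsOptimalWeight a b β κ m₀ w ↔
      ∃ E : Set ℝ, IsOptimalSet a b β κ c E ∧
        w =ᵐ[volume.restrict (Ioo a b)] setWeight a b κ E := by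
  have hba := sub_pos.2 hab
  have hk : 0 < 1 + κ := by linarith
  have hc0 : 0 < c := by rw [hc]; exact div_pos (by linarith) hk
  have hc1 : c < 1 := by rw [hc, div_lt_one hk]; linarith
  obtain ⟨s, hs⟩ : ∃ s, s = (a + b) / 2 - c * (b - a) / 2 := ⟨_, rfl⟩
  obtain ⟨t, ht⟩ : ∃ t, t = (a + b) / 2 + c * (b - a) / 2 := ⟨_, rfl⟩
  rw [← hs, ← ht]
  have hcL := mul_pos hc0 hba
  have hcL1 : c * (b - a) < b - a := mul_lt_of_lt_one_left hba hc1
  have has : a ≤ s := by linarith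
  have htb : t ≤ b := by linarith
  have hst : t - s = c * (b - a) := by rw [hs, ht]; ring
  obtain ⟨lam, v, hl, hev, hC, hva, hvb, y0, y1, y2, hle, hge⟩ :=
    exists_eigenvalue_of_interval hab hβ hκ hm₁ hβm hc has htb hst
  have hlβ : √lam < β := by
    by_contra! hcon
    linarith [hle hcon]
  obtain ⟨V, hV, hVβ, hτ, hA⟩ := hC.exists_level_centered hl hκ has (by linarith) htb hva hvb
    y0 y1 y2 hlβ (by linarith)
  refine optimal_iff_of_family hab hβ hκ hm₁ hβm hc (lamS := lam)
    (Fam := fun s' t' => s' = s ∧ t' = t) ?_ ⟨s, t, rfl, rfl⟩ ?_ ?_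
  · rintro _ _ ⟨rfl, rfl⟩; exact ⟨has, htb, hst⟩
  · rintro _ _ ⟨rfl, rfl⟩; exact hev
  · refine min_weight_of_min_control hab hβ hκ hm₁ hc hl fun θ v' hC' ha' hb' => ?_
    rw [← hst]
    obtain ⟨h1, h2⟩ := hC'.le_integral_of_lt_sq hab.le hl hκ ha' hb' hV hVβ hτ hA (by linarith)
    refine ⟨h1, fun h3 => ⟨s, t, ⟨rfl, rfl⟩, ?_⟩⟩
    have h4 := h2 h3
    rwa [show a + (s - a) = s by ring, show b - (s - a) = t by linarith] at h4

/-- At the threshold all intervals of the right length have the same eigenvalue `β²`. -/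
theorem optimal_iff_interval (hab : a < b) (hκ : 0 < κ) (hm₀ : -κ < m₀) (hm₁ : m₀ < 1)
    (hβ : 0 ≤ β) (hβm : β = 0 → 0 < m₀) (hc : c = (1 - m₀) / (1 + κ))
    (h : β = betaStar c κ / (b - a)) :
    (∀ E : Set ℝ, MeasurableSet E → E ⊆ Ioo a b →
      (IsOptimalSet a b β κ c E ↔ ∃ s t, (a ≤ s ∧ t ≤ b ∧ t - s = c * (b - a)) ∧
        E =ᵐ[volume] Ioo s t)) ∧
    ∀ w : ℝ → ℝ, IsOptimalWeight a b β κ m₀ w ↔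
      ∃ E : Set ℝ, IsOptimalSet a b β κ c E ∧
        w =ᵐ[volume.restrict (Ioo a b)] setWeight a b κ E := by
  have hba := sub_pos.2 hab
  have hk : 0 < 1 + κ := by linarith
  have hc0 : 0 < c := by rw [hc]; exact div_pos (by linarith) hk
  have hc1 : c < 1 := by rw [hc, div_lt_one hk]; linarith
  have hcL1 : c * (b - a) < b - a := mul_lt_of_lt_one_left hba hc1
  have hev : ∀ s t, a ≤ s ∧ t ≤ b ∧ t - s = c * (b - a) →
      0 < β ∧ IsPrincipalEigenvalue a b β (setWeight a b κ (Ioo s t)) (β ^ 2) := by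
    rintro s t ⟨has, htb, hst⟩
    obtain ⟨lam, v, hl, hev, -, -, -, -, -, -, hle, hge⟩ :=
      exists_eigenvalue_of_interval hab hβ hκ hm₁ hβm hc has htb hst
    have hlβ : √lam = β := by
      rcases le_total β (√lam) with h' | h'
      · exact le_antisymm (h ▸ hle h') h'
      · exact le_antisymm h' (h ▸ hge h')
    have hsq : lam = β ^ 2 := by rw [← hlβ, Real.sq_sqrt hl.le]
    exact ⟨hlβ ▸ Real.sqrt_pos.2 hl, hsq ▸ hev⟩
  have hne : a ≤ a ∧ a + c * (b - a) ≤ b ∧ a + c * (b - a) - a = c * (b - a) :=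
    ⟨le_rfl, by linarith, by ring⟩
  have hβ0 := (hev _ _ hne).1
  refine optimal_iff_of_family hab hβ hκ hm₁ hβm hc (lamS := β ^ 2)
    (Fam := fun s t => a ≤ s ∧ t ≤ b ∧ t - s = c * (b - a)) (fun _ _ => id) ⟨_, _, hne⟩
    (fun s t hF => (hev s t hF).2) ?_
  refine min_weight_of_min_control hab hβ hκ hm₁ hc (by positivity) fun θ v' hC' ha' hb' => ?_
  have hT := two_mul_descentTime_sqrt hκ hc0 (lam := β ^ 2) (by positivity)
  rw [Real.sqrt_sq hβ] at hT
  have hT' : 2 * descentTime (β ^ 2) κ β = c * (b - a) := by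
    rw [hT, div_eq_iff hβ0.ne']
    have : betaStar c κ = β * (b - a) := by rw [h]; field_simp
    rw [this]; ring
  obtain ⟨h1, h2⟩ := hC'.le_integral_of_eq_sq hab.le (by positivity) hκ hβ0 rfl ha' hb'
  rw [hT'] at h1 h2
  refine ⟨h1, fun h3 => ?_⟩
  obtain ⟨s, t, h4, h5, h6, h7⟩ := h2 h3
  exact ⟨s, t, ⟨h4, h5, h6⟩, h7⟩

/-- Below the threshold `β < √lam`, and exactly the two intervals at the endpoints are optimal. -/
theorem optimal_iff_edge (hab : a < b) (hκ : 0 < κ) (hm₀ : -κ < m₀) (hm₁ : m₀ < 1)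
    (hβ : 0 ≤ β) (hβm : β = 0 → 0 < m₀) (hc : c = (1 - m₀) / (1 + κ))
    (h : β < betaStar c κ / (b - a)) :
    (∀ E : Set ℝ, MeasurableSet E → E ⊆ Ioo a b →
      (IsOptimalSet a b β κ c E ↔ ∃ s t, ((s = a ∧ t = a + c * (b - a)) ∨
        (s = b - c * (b - a) ∧ t = b)) ∧ E =ᵐ[volume] Ioo s t)) ∧
    ∀ w : ℝ → ℝ, IsOptimalWeight a b β κ m₀ w ↔
      ∃ E : Set ℝ, IsOptimalSet a b β κ c E ∧
        w =ᵐ[volume.restrict (Ioo a b)] setWeight a b κ E := by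
  have hba := sub_pos.2 hab
  have hk : 0 < 1 + κ := by linarith
  have hc0 : 0 < c := by rw [hc]; exact div_pos (by linarith) hk
  have hc1 : c < 1 := by rw [hc, div_lt_one hk]; linarith
  obtain ⟨l, hl⟩ : ∃ l, l = c * (b - a) := ⟨_, rfl⟩
  have hcL := mul_pos hc0 hba
  have hcL1 : c * (b - a) < b - a := mul_lt_of_lt_one_left hba hc1
  obtain ⟨lam, v, hlam, hev, hC, hva, hvb, -, y1, y2, hle, hge⟩ :=
    exists_eigenvalue_of_interval hab hβ hκ hm₁ hβm hc (s := a) (t := a + l) le_rfl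
      (by linarith) (by linarith)
  have hlβ : β < √lam := by
    by_contra! hcon
    linarith [hge hcon]
  obtain ⟨w, hβw, hw, hA, hB⟩ := hC.exists_level_edge hlam hκ (by linarith) (by linarith) hβ hva
    hvb y1 y2 hlβ
  have hev' : IsPrincipalEigenvalue a b β (setWeight a b κ (Ioo (b - l) b)) lam := by
    obtain ⟨h0, u, p, e⟩ := hev
    refine IsPrincipalEigenvalue.congr ?_ ⟨h0, _, _, e.reflect hab.le⟩
    rw [Filter.EventuallyEq, ae_restrict_iff' measurableSet_Ioo]
    refine .of_forall fun x hx => ?_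
    rw [setWeight_apply hx, setWeight_apply (mem_Ioo_reflect.2 hx)]
    by_cases hm : x ∈ Ioo (b - l) b
    · rw [indicator_of_mem hm, indicator_of_mem
        (show a + b - x ∈ Ioo a (a + l) from ⟨by linarith [hm.2], by linarith [hm.1]⟩)]
      simp
    · rw [indicator_of_notMem hm, indicator_of_notMem
        fun hm' : a + b - x ∈ Ioo a (a + l) => hm ⟨by linarith [hm'.2], by linarith [hm'.1]⟩]
  rw [← hl]
  refine optimal_iff_of_family hab hβ hκ hm₁ hβm hc (lamS := lam)
    (Fam := fun s t => (s = a ∧ t = a + l) ∨ (s = b - l ∧ t = b)) ?_ ⟨a, a + l, Or.inl ⟨rfl, rfl⟩⟩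
    ?_ ?_
  · rintro _ _ (⟨rfl, rfl⟩ | ⟨rfl, rfl⟩)
    · exact ⟨le_rfl, by linarith, by linarith⟩
    · exact ⟨by linarith, le_rfl, by linarith⟩
  · rintro _ _ (⟨rfl, rfl⟩ | ⟨rfl, rfl⟩)
    · exact hev
    · exact hev'
  · refine min_weight_of_min_control hab hβ hκ hm₁ hc hlam fun θ v' hC' ha' hb' => ?_
    rw [← hl]
    obtain ⟨h1, h2⟩ := hC'.le_integral_of_sq_lt (l := l) hab.le hlam hκ hβ ha' hb' hβw hw
      (hA.trans (by ring)) (hB.trans (by ring))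
    refine ⟨h1, fun h3 => ?_⟩
    rcases h2 h3 with h4 | h4
    · exact ⟨a, a + l, Or.inl ⟨rfl, rfl⟩, h4⟩
    · exact ⟨b - l, b, Or.inr ⟨rfl, rfl⟩, h4⟩

end

end RobinWeight

theorem mainTheorem3 (a b β κ m₀ c : ℝ) (hab : a < b) (hκ : 0 < κ)
    (hm₀ : -κ < m₀) (hm₁ : m₀ < 1) (hβ : 0 ≤ β) (hβm : β = 0 → 0 < m₀)
    (hc : c = (1 - m₀) / (1 + κ)) :
    (RobinWeight.betaStar c κ / (b - a) < β →
      ∀ E : Set ℝ, MeasurableSet E → E ⊆ Ioo a b →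
        (RobinWeight.IsOptimalSet a b β κ c E ↔
          E =ᵐ[volume] Ioo ((a + b) / 2 - c * (b - a) / 2) ((a + b) / 2 + c * (b - a) / 2))) ∧
    (β = RobinWeight.betaStar c κ / (b - a) →
      ∀ E : Set ℝ, MeasurableSet E → E ⊆ Ioo a b →
        (RobinWeight.IsOptimalSet a b β κ c E ↔
          ∃ s t : ℝ, a ≤ s ∧ t ≤ b ∧ t - s = c * (b - a) ∧ E =ᵐ[volume] Ioo s t)) ∧
    (β < RobinWeight.betaStar c κ / (b - a) →
      ∀ E : Set ℝ, MeasurableSet E → E ⊆ Ioo a b →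
        (RobinWeight.IsOptimalSet a b β κ c E ↔
          E =ᵐ[volume] Ioo a (a + c * (b - a)) ∨ E =ᵐ[volume] Ioo (b - c * (b - a)) b)) ∧
    (∀ m : ℝ → ℝ, RobinWeight.IsOptimalWeight a b β κ m₀ m ↔
      ∃ E : Set ℝ, RobinWeight.IsOptimalSet a b β κ c E ∧
        m =ᵐ[volume.restrict (Ioo a b)] RobinWeight.setWeight a b κ E) := by
  refine ⟨fun h E hE hEs => ?_, fun h E hE hEs => ?_, fun h E hE hEs => ?_, ?_⟩
  · rw [(RobinWeight.optimal_iff_centered hab hκ hm₀ hm₁ hβ hβm hc h).1 E hE hEs]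
    constructor
    · rintro ⟨_, _, ⟨rfl, rfl⟩, h1⟩; exact h1
    · exact fun h1 => ⟨_, _, ⟨rfl, rfl⟩, h1⟩
  · rw [(RobinWeight.optimal_iff_interval hab hκ hm₀ hm₁ hβ hβm hc h).1 E hE hEs]
    simp only [and_assoc]
  · rw [(RobinWeight.optimal_iff_edge hab hκ hm₀ hm₁ hβ hβm hc h).1 E hE hEs]
    constructor
    · rintro ⟨_, _, ⟨rfl, rfl⟩ | ⟨rfl, rfl⟩, h1⟩
      · exact Or.inl h1
      · exact Or.inr h1
    · rintro (h1 | h1)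
      · exact ⟨_, _, Or.inl ⟨rfl, rfl⟩, h1⟩
      · exact ⟨_, _, Or.inr ⟨rfl, rfl⟩, h1⟩
  · rcases lt_trichotomy β (RobinWeight.betaStar c κ / (b - a)) with h | h | h
    · exact (RobinWeight.optimal_iff_edge hab hκ hm₀ hm₁ hβ hβm hc h).2
    · exact (RobinWeight.optimal_iff_interval hab hκ hm₀ hm₁ hβ hβm hc h).2
    · exact (RobinWeight.optimal_iff_centered hab hκ hm₀ hm₁ hβ hβm hc h).2
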